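/- Let $\mathbb N=\{1,2,\dots\}$ and $\mathbb N^*=\mathbb N\cup\{\infty\}$ with the metric $d(i,j)=\sum_{k=i}^{j-1}2^{-k}$, $1\le i<j\le\infty$. Let $S(\mathbb N,\mathbb N^*)$ be the set of functions $\sigma:\mathbb N\to\mathbb N^*$ such that $\sigma_i=\sigma_j$ with $i\ne j$ implies $\sigma_i=\infty$; with $D(\sigma,\tau)=\sum_{i\ge1}2^{-i}d(\sigma_i,\tau_i)$ it is a compact metric space. Let $S(\mathbb N,\mathbb N)$ be its subset of injections $\mathbb N\to\mathbb N$ and $S_{\rm sur}(\mathbb N,\mathbb N^*)$ its subset of surjections onto $\mathbb N^*$. A permutation $\sigma$ of $\{1,\dots,n\}$ is regarded as an element of $S(\mathbb N,\mathbb N^*)$ by setting $\sigma_j=j$ for $j>n$. Let $\mu_n$ be the uniform distribution on the $213$-avoiding permutations of $\{1,\dots,n\}$, that is, those for which there are no $i<j<k$ with $\sigma_j<\sigma_i<\sigma_k$; it is regarded as a probability measure on $S(\mathbb N,\mathbb N^*)$. Let $\{X_n\}_{n\ge1}$, $\{\hat X_n\}_{n\ge1}$, $\{Y^{(1)}_n\}_{n\ge1}$,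 $\{Y^{(2)}_n\}_{n\ge1}$ and $\chi$ be mutually independent random variables, where each sequence is IID, with $$P(X_1=k)=P(\hat X_1=k+1)=\frac{C_k}{2\cdot4^k}\quad(k=0,1,2,\dots),\qquad C_k=\frac1{k+1}\binom{2k}{k},$$ $P(Y^{(i)}_1=k)=2^{-k}$ for $k\in\mathbb N$ and $i=1,2$, and $P(\chi=0)=P(\chi=1)=\frac12$; here $\hat X_n$ and $Y^{(i)}_n$ take values in $\mathbb N$. Write $T^{Z}_n=\sum_{j=1}^nZ_j$, $T^Z_0=0$, for $Z=\hat X,Y^{(1)},Y^{(2)}$, and $[a,b]=\{a,a+1,\dots,b\}$. Put $$I^{(1)}=\bigcup_{n=0}^\infty\Big[T^{Y^{(1)}}_n+T^{\hat X}_{T^{Y^{(2)}}_n}+1,\ T^{Y^{(1)}}_{n+1}+T^{\hat X}_{T^{Y^{(2)}}_n}\Big],\qquad I^{(0)}=\bigcup_{n=0}^\infty\Big[T^{Y^{(1)}}_n+T^{\hat X}_{T^{Y^{(2)}}_{n+1}}+1,\ T^{Y^{(1)}}_{n+1}+T^{\hat X}_{T^{Y^{(2)}}_{n+1}}\Big].$$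 For an infinite set $I=\{i_1<i_2<\cdots\}\subset\mathbb N$ and $J=\{J_n\}_{n\ge1}$ with $J_n\in\{0,1,2,\dots\}$, let $\infty^{(J)}*I$ be the element of $S(\mathbb N,\mathbb N^*)$ whose consecutive values are $J_1$ times $\infty$, then $i_1$, then $J_2$ times $\infty$, then $i_2$, and so on. Then, as $n\to\infty$, $\mu_n$ converges weakly to the distribution of the $S(\mathbb N,\mathbb N^*)$-valued random variable that equals $\infty^{(J)}*I^{(1)}$ if $\chi=1$ and $\infty^{(J)}*I^{(0)}$ if $\chi=0$, where $J=\{X_n\}_{n\ge1}$; and almost surely this random variable lies neither in $S(\mathbb N,\mathbb N)$ nor in $S_{\rm sur}(\mathbb N,\mathbb N^*)$. -/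

import Mathlib

open MeasureTheory ProbabilityTheory Filter Topology
open scoped OnePoint

noncomputable section

/-! ### The compact metric space of functions from `ℕ` to `ℕ*` -/

/-- `ℕ* = {1, 2, …} ∪ {∞}`. -/
abbrev NStar : Type := OnePoint ℕ+

namespace NStar

/-- `w i = ∑_{k ≥ i} 2 ^ (-k) = 2 ^ (1 - i)` for `i ∈ ℕ`, and `w ∞ = 0`. -/
def weight : NStar → ℝ
  | ∞ => 0
  | (i : ℕ+) => 2 * (1 / 2 : ℝ) ^ (i : ℕ)

@[simp] theorem weight_infty : weight ∞ = 0 := rfl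

@[simp] theorem weight_coe (i : ℕ+) : weight (i : NStar) = 2 * (1 / 2 : ℝ) ^ (i : ℕ) := rfl

theorem weight_injective : Function.Injective weight := by
  intro a b h
  induction a using OnePoint.rec with
  | infty =>
    induction b using OnePoint.rec with
    | infty => rfl
    | coe j => simp at h
  | coe i =>
    induction b using OnePoint.rec with
    | infty => simp at h
    | coe j =>
      have h2 : (1 / 2 : ℝ) ^ (i : ℕ) = (1 / 2 : ℝ) ^ (j : ℕ) := by
        simpa only [weight_coe, mul_right_inj' (two_ne_zero' ℝ)] using h
      have h3 : (i : ℕ) = (j : ℕ) :=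
        pow_right_injective₀ (by norm_num) (by norm_num) h2
      rw [PNat.coe_injective h3]

theorem continuous_weight : Continuous weight := by
  rw [OnePoint.continuous_iff_from_discrete]
  have h1 : Tendsto (fun n : ℕ => 2 * (1 / 2 : ℝ) ^ n) cofinite (𝓝 (2 * 0)) := by
    rw [Nat.cofinite_eq_atTop]
    exact (tendsto_pow_atTop_nhds_zero_of_lt_one (by norm_num) (by norm_num)).const_mul 2
  rw [mul_zero] at h1
  exact h1.comp PNat.coe_injective.tendsto_cofinite

/-- The metric `d(i, j) = ∑_{k=i}^{j-1} 2 ^ (-k)` (for `i < j ≤ ∞`) on `ℕ*`, written in summed form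
as `|w i - w j|`. It induces the topology of the one-point compactification. -/
instance : MetricSpace NStar :=
  (MetricSpace.induced weight weight_injective inferInstance).replaceTopology
    (continuous_weight.isClosedEmbedding weight_injective).isInducing.eq_induced

theorem dist_def (a b : NStar) : dist a b = |weight a - weight b| := rfl

theorem dist_coe_coe {i j : ℕ+} (h : i < j) :
    dist (i : NStar) (j : NStar) = ∑ k ∈ Finset.Ico (i : ℕ) j, (1 / 2 : ℝ) ^ k := by
  have hij : (i : ℕ) ≤ j := h.le
  have hle : (1 / 2 : ℝ) ^ (j : ℕ) ≤ (1 / 2 : ℝ) ^ (i : ℕ) :=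
    pow_le_pow_of_le_one (by norm_num) (by norm_num) hij
  rw [dist_def, geom_sum_Ico (by norm_num) hij, weight_coe, weight_coe, abs_of_nonneg (by linarith)]
  ring

theorem dist_coe_infty (i : ℕ+) :
    dist (i : NStar) ∞ = ∑' k : ℕ, (1 / 2 : ℝ) ^ ((i : ℕ) + k) := by
  simp only [pow_add, tsum_mul_left, tsum_geometric_two]
  rw [dist_def, weight_coe, weight_infty, sub_zero, abs_of_nonneg (by positivity)]
  ring

theorem dist_le_two (a b : NStar) : dist a b ≤ 2 := by
  have h : ∀ c : NStar, 0 ≤ weight c ∧ weight c ≤ 2 := by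
    intro c
    induction c using OnePoint.rec with
    | infty => simp
    | coe i =>
      rw [weight_coe]
      have := pow_le_one₀ (n := (i : ℕ)) (a := (1 / 2 : ℝ)) (by norm_num) (by norm_num)
      exact ⟨by positivity, by linarith⟩
  rw [dist_def, abs_le]
  constructor <;> linarith [(h a).1, (h a).2, (h b).1, (h b).2]

end NStar

/-- `S(ℕ, ℕ*)`: the functions `σ : {1, 2, …} → ℕ*` such that `σ i = σ j` with `i ≠ j` only if the
common value is `∞`. It carries the topology of pointwise convergence, which is that of the metric
`D` below. -/
def SeqSpace : Type := {σ : ℕ+ → NStar // ∀ i j, i ≠ j → σ i = σ j → σ i = ∞}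

namespace SeqSpace

instance : CoeFun SeqSpace fun _ => ℕ+ → NStar := ⟨Subtype.val⟩

instance : TopologicalSpace SeqSpace := instTopologicalSpaceSubtype

theorem continuous_apply (i : ℕ+) : Continuous fun σ : SeqSpace => σ i :=
  (_root_.continuous_apply i).comp continuous_subtype_val

instance : CompactSpace SeqSpace := by
  refine isCompact_iff_compactSpace.mp (IsClosed.isCompact ?_)
  have hset : {σ : ℕ+ → NStar | ∀ i j, i ≠ j → σ i = σ j → σ i = ∞} =
      ⋂ (i : ℕ+) (j : ℕ+) (_ : i ≠ j), {σ : ℕ+ → NStar | σ i = σ j → σ i = ∞} := by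
    ext σ
    simp
  change IsClosed {σ : ℕ+ → NStar | ∀ i j, i ≠ j → σ i = σ j → σ i = ∞}
  rw [hset]
  refine isClosed_iInter fun i => isClosed_iInter fun j => isClosed_iInter fun _ => ?_
  rw [← isOpen_compl_iff, isOpen_iff_mem_nhds]
  intro σ hσ
  have h1 : σ i = σ j ∧ σ i ≠ ∞ := by simpa using hσ
  obtain ⟨v, hv⟩ := OnePoint.ne_infty_iff_exists.mp h1.2
  have hopen : IsOpen ({(v : NStar)} : Set NStar) := by
    rw [← Set.image_singleton, OnePoint.isOpen_image_coe]
    exact isOpen_discrete _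
  have hi : ∀ᶠ ρ : ℕ+ → NStar in 𝓝 σ, ρ i ∈ ({(v : NStar)} : Set NStar) :=
    (_root_.continuous_apply i).continuousAt (hopen.mem_nhds (by simp [hv]))
  have hj : ∀ᶠ ρ : ℕ+ → NStar in 𝓝 σ, ρ j ∈ ({(v : NStar)} : Set NStar) :=
    (_root_.continuous_apply j).continuousAt (hopen.mem_nhds (by simp [hv, h1.1]))
  filter_upwards [hi, hj] with ρ hρi hρj
  rw [Set.mem_singleton_iff] at hρi hρj
  simp [hρi, hρj]

/-- The metric `D(σ, τ) = ∑_{i ≥ 1} d(σ_i, τ_i) / 2 ^ i`. -/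
def D (σ τ : SeqSpace) : ℝ := ∑' i : ℕ+, dist (σ i) (τ i) / 2 ^ (i : ℕ)

theorem summable_bound : Summable fun i : ℕ+ => (2 : ℝ) / 2 ^ (i : ℕ) := by
  have h : Summable fun n : ℕ => (2 : ℝ) * (1 / 2) ^ n := summable_geometric_two.mul_left 2
  refine (h.comp_injective PNat.coe_injective).congr fun i => ?_
  simp [div_eq_mul_inv]

theorem term_le (σ τ : SeqSpace) (i : ℕ+) :
    dist (σ i) (τ i) / 2 ^ (i : ℕ) ≤ 2 / 2 ^ (i : ℕ) := by
  gcongr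
  exact NStar.dist_le_two _ _

theorem summable_D (σ τ : SeqSpace) : Summable fun i : ℕ+ => dist (σ i) (τ i) / 2 ^ (i : ℕ) :=
  Summable.of_nonneg_of_le (fun _ => by positivity) (term_le σ τ) summable_bound

/-- The metric space structure given by `D`, before its topology is identified. -/
abbrev metricD : MetricSpace SeqSpace where
  dist := D
  dist_self σ := by simp [D]
  dist_comm σ τ := by simp only [D, dist_comm]
  dist_triangle σ τ ρ := by
    rw [D, D, D, ← (summable_D σ τ).tsum_add (summable_D τ ρ)]
    refine (summable_D σ ρ).tsum_le_tsum (fun i => ?_) ((summable_D σ τ).add (summable_D τ ρ))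
    rw [← add_div]
    gcongr
    exact dist_triangle _ _ _
  eq_of_dist_eq_zero := by
    intro σ τ h
    have hs := (summable_D σ τ).hasSum
    rw [show ∑' i : ℕ+, dist (σ i) (τ i) / 2 ^ (i : ℕ) = 0 from h] at hs
    have h0 := (hasSum_zero_iff_of_nonneg (fun i => by positivity)).mp hs
    refine Subtype.ext (funext fun i => ?_)
    have := congrFun h0 i
    simpa using this

theorem continuous_D (σ : SeqSpace) : Continuous fun τ => D τ σ :=
  continuous_tsum (fun i => ((continuous_apply i).dist continuous_const).div_const _)
    summable_bound fun i τ => by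
      rw [Real.norm_of_nonneg (by positivity)]
      exact term_le τ σ i

theorem eq_induced_of_continuous_dist {A B : Type*} [t : TopologicalSpace A] [CompactSpace A]
    [MetricSpace B] (f : A → B) (hf : Function.Injective f)
    (h : ∀ b, Continuous fun a => dist (f a) (f b)) :
    t = TopologicalSpace.induced f inferInstance := by
  have hcont : Continuous f := by
    rw [continuous_iff_continuousAt]
    intro b
    rw [ContinuousAt, tendsto_iff_dist_tendsto_zero]
    simpa using (h b).tendsto b
  exact (hcont.isClosedEmbedding hf).isInducing.eq_induced

theorem topology_eq : (inferInstance : TopologicalSpace SeqSpace) =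
    metricD.toPseudoMetricSpace.toUniformSpace.toTopologicalSpace := by
  have h := @eq_induced_of_continuous_dist SeqSpace SeqSpace _ _ metricD id
    Function.injective_id continuous_D
  exact h.trans (@induced_id _ metricD.toPseudoMetricSpace.toUniformSpace.toTopologicalSpace)

/-- `S(ℕ, ℕ*)` with the metric `D`. -/
instance : MetricSpace SeqSpace := metricD.replaceTopology topology_eq

/-- The Borel `σ`-algebra. -/
instance : MeasurableSpace SeqSpace := borel SeqSpace

instance : BorelSpace SeqSpace := ⟨rfl⟩

/-- `S(ℕ, ℕ)`: the injections from `ℕ` to `ℕ`. -/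
def injections : Set SeqSpace :=
  {σ | ∃ f : ℕ+ → ℕ+, Function.Injective f ∧ ∀ i, σ i = (f i : NStar)}

/-- `S_sur(ℕ, ℕ*)`: the surjections from `ℕ` to `ℕ*`. -/
def surjections : Set SeqSpace := {σ | Function.Surjective (σ : ℕ+ → NStar)}

end SeqSpace

/-! ### Pattern avoidance and the uniform measures -/

namespace PatternAvoidance

/-- `σ ∈ S_n` contains `τ ∈ S_m`: some subsequence of `σ` is ordered as `τ` is. -/
def Contains {m n : ℕ} (σ : Equiv.Perm (Fin n)) (τ : Equiv.Perm (Fin m)) : Prop :=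
  ∃ i : Fin m → Fin n, StrictMono i ∧ ∀ j k, σ (i j) < σ (i k) ↔ τ j < τ k

/-- The permutation `τ = 213`. -/
def tau213 : Equiv.Perm (Fin 3) := Equiv.swap 0 1

open Classical in
/-- `S_n(213)`: the `213`-avoiding permutations. -/
def avoiders (n : ℕ) : Finset (Equiv.Perm (Fin n)) :=
  Finset.univ.filter fun σ => ¬ Contains σ tau213

theorem avoiders_nonempty (n : ℕ) : (avoiders n).Nonempty := by
  refine ⟨1, ?_⟩
  simp only [avoiders, Finset.mem_filter, Finset.mem_univ, true_and]
  rintro ⟨i, hi, h⟩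
  have h1 := (h 0 1).mp (by simpa using hi (by decide))
  revert h1
  decide

/-- The extension of `σ ∈ S_n` by `σ_j = j` for `j > n`, as a function on `{1, 2, …}`
(the elements `1, …, n` correspond to `0, …, n - 1` in `Fin n`). -/
def extend {n : ℕ} (σ : Equiv.Perm (Fin n)) (j : ℕ+) : ℕ+ :=
  if h : j.natPred < n then (σ ⟨j.natPred, h⟩ : ℕ).succPNat else j

theorem extend_injective {n : ℕ} (σ : Equiv.Perm (Fin n)) : Function.Injective (extend σ) := by
  have key : ∀ j : ℕ+, (extend σ j).natPred < n ↔ j.natPred < n := by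
    intro j
    unfold extend
    split_ifs with h
    · simp [h]
    · simp [h]
  intro a b hab
  have ha := key a
  rw [hab, key b] at ha
  unfold extend at hab
  by_cases h : a.natPred < n
  · rw [dif_pos h, dif_pos (ha.mpr h)] at hab
    have h1 := σ.injective (Fin.ext (Nat.succPNat_injective hab))
    exact PNat.natPred_injective (by simpa using h1)
  · rwa [dif_neg h, dif_neg (fun hb => h (ha.mp hb))] at hab

/-- The inclusion `S_n ⊂ S(ℕ, ℕ*)`. -/
def toSeqSpace {n : ℕ} (σ : Equiv.Perm (Fin n)) : SeqSpace :=
  ⟨fun j => (extend σ j : NStar), fun _ _ hij h =>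
    absurd (extend_injective σ (OnePoint.coe_injective h)) hij⟩

/-- `μ_n`: the uniform distribution on `S_n(213)`, as a probability measure on `S(ℕ, ℕ*)`. -/
def mu213 (n : ℕ) : ProbabilityMeasure SeqSpace :=
  ⟨((PMF.uniformOfFinset (avoiders n) (avoiders_nonempty n)).map toSeqSpace).toMeasure,
    inferInstance⟩

end PatternAvoidance

/-! ### The functions `∞^{(J)} * I` -/

namespace Limit213

/-- For an infinite set `I = {i_1 < i_2 < ⋯}` of positive integers, `enum I k = i_{k+1}`. -/
def enum (I : Set ℕ+) (k : ℕ) : ℕ+ := (Nat.nth (fun m => m.succPNat ∈ I) k).succPNat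

theorem enum_strictMono {I : Set ℕ+} (hI : I.Infinite) : StrictMono (enum I) := by
  refine Nat.succPNat_strictMono.comp (Nat.nth_strictMono ?_)
  refine hI.preimage (f := Nat.succPNat) fun v _ => ⟨v.natPred, by simp⟩

theorem range_enum {I : Set ℕ+} (hI : I.Infinite) : Set.range (enum I) = I := by
  have hinf : (Set.ofPred fun m : ℕ => m.succPNat ∈ I).Infinite :=
    hI.preimage (f := Nat.succPNat) fun v _ => ⟨v.natPred, by simp⟩
  ext v
  constructor
  · rintro ⟨k, rfl⟩
    exact Nat.nth_mem_of_infinite hinf k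
  · intro hv
    have h : v.natPred ∈ Set.range (Nat.nth fun m : ℕ => m.succPNat ∈ I) := by
      rw [Nat.range_nth_of_infinite hinf]
      simpa using hv
    obtain ⟨k, hk⟩ := h
    exact ⟨k, by simp [enum, hk]⟩

/-- `partialSum a n = a_1 + ⋯ + a_n`, where `a_{j+1}` is stored as `a j`. -/
def partialSum (a : ℕ → ℕ) (n : ℕ) : ℕ := ∑ j ∈ Finset.range n, a j

open Classical in
/-- The function `∞^{(J_1)} * (i_1) * ∞^{(J_2)} * (i_2) * ⋯`, where `I = {i_1 < i_2 < ⋯}` and `J_{k+1}`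
is stored as `J k` (an empty block of `∞` if that is zero): the value `i_{k+1}` stands at the
position `(J_1 + 1) + ⋯ + (J_{k+1} + 1)`, and `∞` at all other positions. -/
def concatFun (J : ℕ → ℕ) (I : Set ℕ+) (p : ℕ+) : NStar :=
  if h : ∃ k, (p : ℕ) = partialSum (fun j => J j + 1) (k + 1) then
    (enum I (Nat.find h) : NStar) else ∞

/-- `∞^{(J)} * I` as an element of `S(ℕ, ℕ*)`. -/
def concat (J : ℕ → ℕ) (I : Set ℕ+) (hI : I.Infinite) : SeqSpace :=
  ⟨concatFun J I, by
    intro p q hpq h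
    by_contra hne
    classical
    unfold concatFun at h hne
    by_cases hp : ∃ k, (p : ℕ) = partialSum (fun j => J j + 1) (k + 1)
    · by_cases hq : ∃ k, (q : ℕ) = partialSum (fun j => J j + 1) (k + 1)
      · rw [dif_pos hp, dif_pos hq] at h
        have h1 := (enum_strictMono hI).injective (OnePoint.coe_injective h)
        apply hpq
        have h2 := Nat.find_spec hp
        rw [h1, ← Nat.find_spec hq] at h2
        exact PNat.coe_injective h2
      · rw [dif_pos hp, dif_neg hq] at h
        exact OnePoint.coe_ne_infty _ h
    · exact hne (dif_neg hp)⟩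

/-- `⋃_{n ≥ 0} [T_n^{Y1} + T^{X̂}_{T_n^{Y2}} + 1, T_{n+1}^{Y1} + T^{X̂}_{T_n^{Y2}}]`. -/
def valueSet1 (Xhat Y1 Y2 : ℕ → ℕ+) : Set ℕ+ :=
  {v | ∃ n : ℕ,
    partialSum (fun j => Y1 j) n + partialSum (fun j => Xhat j) (partialSum (fun j => Y2 j) n) + 1
        ≤ (v : ℕ) ∧
    (v : ℕ) ≤ partialSum (fun j => Y1 j) (n + 1)
        + partialSum (fun j => Xhat j) (partialSum (fun j => Y2 j) n)}

/-- `⋃_{n ≥ 0} [T_n^{Y1} + T^{X̂}_{T_{n+1}^{Y2}} + 1, T_{n+1}^{Y1} + T^{X̂}_{T_{n+1}^{Y2}}]`. -/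
def valueSet0 (Xhat Y1 Y2 : ℕ → ℕ+) : Set ℕ+ :=
  {v | ∃ n : ℕ,
    partialSum (fun j => Y1 j) n
        + partialSum (fun j => Xhat j) (partialSum (fun j => Y2 j) (n + 1)) + 1 ≤ (v : ℕ) ∧
    (v : ℕ) ≤ partialSum (fun j => Y1 j) (n + 1)
        + partialSum (fun j => Xhat j) (partialSum (fun j => Y2 j) (n + 1))}

theorem le_partialSum (a : ℕ → ℕ+) (n : ℕ) : n ≤ partialSum (fun j => a j) n := by
  have h := Finset.card_nsmul_le_sum (Finset.range n) (fun j => ((a j : ℕ+) : ℕ)) 1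
    fun j _ => (a j).pos
  simpa [partialSum] using h

theorem partialSum_lt (a : ℕ → ℕ+) (n : ℕ) :
    partialSum (fun j => a j) n + 1 ≤ partialSum (fun j => a j) (n + 1) := by
  rw [partialSum, partialSum, Finset.sum_range_succ]
  have := (a n).pos
  omega

theorem infinite_of_forall_exists {I : Set ℕ+} (h : ∀ n : ℕ, ∃ v ∈ I, n < (v : ℕ)) :
    I.Infinite := by
  refine Set.infinite_of_not_bddAbove ?_
  rintro ⟨b, hb⟩
  obtain ⟨v, hv, hlt⟩ := h b
  exact absurd (hb hv) (not_le.mpr hlt)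

theorem valueSet1_infinite (Xhat Y1 Y2 : ℕ → ℕ+) : (valueSet1 Xhat Y1 Y2).Infinite := by
  refine infinite_of_forall_exists fun n => ?_
  refine ⟨(partialSum (fun j => Y1 j) n
    + partialSum (fun j => Xhat j) (partialSum (fun j => Y2 j) n)).succPNat, ⟨n, ?_, ?_⟩, ?_⟩
  · simp
  · have := partialSum_lt Y1 n
    simp only [Nat.succPNat_coe]
    omega
  · have := le_partialSum Y1 n
    simp only [Nat.succPNat_coe]
    omega

theorem valueSet0_infinite (Xhat Y1 Y2 : ℕ → ℕ+) : (valueSet0 Xhat Y1 Y2).Infinite := by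
  refine infinite_of_forall_exists fun n => ?_
  refine ⟨(partialSum (fun j => Y1 j) n
    + partialSum (fun j => Xhat j) (partialSum (fun j => Y2 j) (n + 1))).succPNat,
    ⟨n, ?_, ?_⟩, ?_⟩
  · simp
  · have := partialSum_lt Y1 n
    simp only [Nat.succPNat_coe]
    omega
  · have := le_partialSum Y1 n
    simp only [Nat.succPNat_coe]
    omega

/-- `χ · (∞^{(J)} * I^{(1)}) + (1 - χ) · (∞^{(J)} * I^{(0)})` with `J = (X_n)`. -/
def limitFun (X : ℕ → ℕ) (Xhat Y1 Y2 : ℕ → ℕ+) (χ : Fin 2) : SeqSpace :=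
  if χ = 1 then concat X (valueSet1 Xhat Y1 Y2) (valueSet1_infinite Xhat Y1 Y2)
  else concat X (valueSet0 Xhat Y1 Y2) (valueSet0_infinite Xhat Y1 Y2)

/-- Discreteness of the `σ`-algebra on the positive integers. -/
instance : MeasurableSpace ℕ+ := ⊤

/-- The `σ`-algebra generated by a random variable. -/
abbrev sigmaAlg {Ω E : Type*} [mE : MeasurableSpace E] (f : Ω → E) : MeasurableSpace Ω :=
  mE.comap f

end Limit213

end

/-! A `213`-avoiding permutation splits at its smallest value: if that value stands at position `j +
1`, every entry before it exceeds every entry after it, so the permutation is a raised `213`-avoider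
of length `j`, the minimum, and a raised `213`-avoider of length `k = n - j` (`glue`,
`exists_glue_eq`). This gives the Catalan count, and the split at `j` has probability `C_j C_{n-j} /
C_{n+1}`. For fixed `j` this tends to `C_j / 4^(j+1)`, and so does the probability of the split at
`n - j`; these limits sum to `1/2`, so in the limit exactly one of the two blocks is short.

If the left block has bounded length `j`, its values escape to `∞`, and the permutation is close to
`SeqSpace.prepend j` of the right block. If the right block has bounded length `j`, the permutation
is close to the left block with all values raised by `j + 1`, that is, to `SeqSpace.shift`. A weak
limit should therefore satisfy Λ = ∑_j C_j / 4^(j+1) · (law of `prepend j` under Λ + law of `shift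
(j+1)` under Λ).

The announced random variable solves this equation (`limitLaw_eq_sum`). It is driven by a two-state
process: in state 1 it places the next value after a block of `X` infinities, in state 0 it skips
`Xhat` values. The geometric variables `Y1` and `Y2` are the sojourn times; being memoryless with
parameter `1/2`, they make the state after every step a fresh fair coin, distributed as `χ`.

Both maps are `1/2`-Lipschitz. Hence for Lipschitz `f` the asymptotic gap between the average of `f`
over the avoiders and its integral against a solution Λ is halved by each use of the recursion
(`eventually_abs_average_sub_integral_le`); the interchange of limit and sum is
`eventually_abs_weighted_sum_sub_le`. Lipschitz test functions suffice for weak convergence.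

The limit is never surjective because the value sets have gaps, and it is not an injection into the
finite values as soon as some `X` is nonzero. -/

namespace NStar

/-! ### Translations of `ℕ*` -/

/-- Translation `v ↦ x + v` of `ℕ*`, fixing `∞`. -/
def shift (x : ℕ+) : NStar → NStar := OnePoint.map (x + ·)

@[simp] theorem shift_infty (x : ℕ+) : shift x ∞ = ∞ := rfl

@[simp] theorem shift_coe (x v : ℕ+) : shift x (v : NStar) = ((x + v : ℕ+) : NStar) := rfl

theorem weight_shift (x : ℕ+) (v : NStar) :
    weight (shift x v) = (1 / 2 : ℝ) ^ (x : ℕ) * weight v := by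
  induction v using OnePoint.rec with
  | infty => simp
  | coe v => simp [pow_add]; ring

theorem dist_shift (x : ℕ+) (a b : NStar) :
    dist (shift x a) (shift x b) = (1 / 2 : ℝ) ^ (x : ℕ) * dist a b := by
  rw [dist_def, dist_def, weight_shift, weight_shift, ← mul_sub, abs_mul,
    abs_of_nonneg (by positivity)]

/-- The weight is geometric and `x ≥ 1`. This factor `1/2` is the contraction behind the
convergence. -/
theorem dist_shift_le (x : ℕ+) (a b : NStar) :
    dist (shift x a) (shift x b) ≤ 1 / 2 * dist a b := by
  rw [dist_shift]
  gcongr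
  exact (pow_le_pow_of_le_one (by norm_num) (by norm_num) x.pos).trans (by norm_num)

theorem shift_injective (x : ℕ+) : Function.Injective (shift x) := by
  intro a b h
  rw [← dist_eq_zero, dist_shift] at h
  simpa using h

theorem shift_eq_infty {x : ℕ+} {a : NStar} : shift x a = ∞ ↔ a = ∞ :=
  ⟨fun h => shift_injective x (by simpa using h), fun h => by simp [h]⟩

theorem shift_ne_one (x : ℕ+) (a : NStar) : shift x a ≠ ((1 : ℕ+) : NStar) := by
  induction a using OnePoint.rec with
  | infty => simp
  | coe v =>
    intro h
    have h1 := congrArg PNat.val (OnePoint.coe_injective h)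
    have := x.pos
    have := v.pos
    simp only [PNat.val_ofNat, PNat.add_coe] at h1
    omega

theorem weight_nonneg (a : NStar) : 0 ≤ weight a := by
  induction a using OnePoint.rec with
  | infty => simp
  | coe i => rw [weight_coe]; positivity

theorem weight_coe_le {N : ℕ} {i : ℕ+} (h : N ≤ i) : weight (i : NStar) ≤ 2 * (1 / 2 : ℝ) ^ N := by
  rw [weight_coe]
  gcongr ?_ * ?_
  exact pow_le_pow_of_le_one (by norm_num) (by norm_num) h

/-- Small weight means near `∞`, so large values are close to one another and to `∞`, whatever they
are. -/
theorem dist_le_of_weight_le {a b : NStar} {ε : ℝ} (ha : weight a ≤ ε) (hb : weight b ≤ ε) :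
    dist a b ≤ ε := by
  rw [dist_def, abs_le]
  constructor <;> linarith [weight_nonneg a, weight_nonneg b]

end NStar

/-! ### The contractions of the sequence space -/

/-- `q ↦ N + q` as a map of positive integers. -/
def natAddPNat (N : ℕ) (q : ℕ+) : ℕ+ := ⟨N + q, by have := q.pos; omega⟩

@[simp] theorem natAddPNat_coe (N : ℕ) (q : ℕ+) : (natAddPNat N q : ℕ) = N + q := rfl

theorem natAddPNat_injective (N : ℕ) : Function.Injective (natAddPNat N) := by
  intro a b hab
  have := congrArg PNat.val hab
  exact PNat.eq (by simpa using this)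

theorem exists_natAddPNat {N : ℕ} {p : ℕ+} (h : N < p) : ∃ q, natAddPNat N q = p := by
  refine ⟨(p - N : ℕ).toPNat', PNat.eq ?_⟩
  rw [natAddPNat_coe, Nat.toPNat'_coe, if_pos (by omega)]
  omega

namespace SeqSpace

theorem dist_eq_D (σ τ : SeqSpace) : dist σ τ = D σ τ := rfl

theorem hasSum_half_pow : HasSum (fun i : ℕ+ => (1 / 2 : ℝ) ^ (i : ℕ)) 1 := by
  have h : HasSum (fun n : ℕ => (1 / 2 : ℝ) ^ (n + 1)) 1 := by
    simpa [pow_succ] using hasSum_geometric_two.mul_right (1 / 2 : ℝ)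
  refine (Equiv.pnatEquivNat.symm.hasSum_iff).mp ?_
  convert! h using 2

/-- Beyond position `N` each entry distance is at most `2`, and the tail `∑_{i > N} 2 · 2^(-i)`
equals `2 · 2^(-N)`; the head costs at most `ε ∑ 2^(-i) = ε`. -/
theorem dist_le_add {σ τ : SeqSpace} {ε : ℝ} (N : ℕ)
    (h : ∀ i : ℕ+, (i : ℕ) ≤ N → dist (σ i) (τ i) ≤ ε) (hε : 0 ≤ ε) :
    dist σ τ ≤ ε + 2 * (1 / 2) ^ N := by
  set u : ℕ+ → ℝ := fun i => if N < i then 2 * (1 / 2) ^ (i : ℕ) else 0 with hu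
  have hsum : HasSum u (2 * (1 / 2) ^ N) := by
    refine ((natAddPNat_injective N).hasSum_iff (fun x hx => ?_)).mp ?_
    · exact if_neg fun hlt => hx (exists_natAddPNat hlt)
    · have := hasSum_half_pow.mul_left (2 * (1 / 2 : ℝ) ^ N)
      rw [mul_one] at this
      convert! this using 2 with q
      have := q.pos
      simp only [hu, Function.comp]
      rw [if_pos (by rw [natAddPNat_coe]; omega), natAddPNat_coe, pow_add]
      ring
  have hε' := (hasSum_half_pow.mul_left ε).add hsum
  rw [mul_one] at hε'
  rw [dist_eq_D, D]
  refine hasSum_le (fun i => ?_) (summable_D σ τ).hasSum hε'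
  rw [div_eq_mul_one_div, ← one_div_pow]
  by_cases hi : (i : ℕ) ≤ N
  · simp only [hu, if_neg (not_lt.mpr hi), add_zero]
    gcongr
    exact h i hi
  · simp only [hu, if_pos (not_le.mp hi)]
    have h1 : dist (σ i) (τ i) * (1 / 2 : ℝ) ^ (i : ℕ) ≤ 2 * (1 / 2) ^ (i : ℕ) := by
      gcongr
      exact NStar.dist_le_two _ _
    have h2 : 0 ≤ ε * (1 / 2 : ℝ) ^ (i : ℕ) := by positivity
    linarith

theorem dist_le_two (σ τ : SeqSpace) : dist σ τ ≤ 2 := by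
  simpa using dist_le_add (σ := σ) (τ := τ) (ε := 0) 0 (fun i hi => absurd hi (by simp)) le_rfl

/-- `i ↦ x + σ i`. -/
def shift (x : ℕ+) (σ : SeqSpace) : SeqSpace :=
  ⟨fun i => NStar.shift x (σ i), fun i j hij h =>
    NStar.shift_eq_infty.mpr (σ.2 i j hij (NStar.shift_injective x h))⟩

@[simp] theorem shift_apply (x : ℕ+) (σ : SeqSpace) (i : ℕ+) :
    shift x σ i = NStar.shift x (σ i) := rfl

/-- The sequence `∞, …, ∞, 1, 1 + σ 1, 1 + σ 2, …` starting with `j` times `∞`. -/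
def prependFun (j : ℕ) (σ : SeqSpace) (p : ℕ+) : NStar :=
  if j + 1 < p then NStar.shift 1 (σ (p - (j + 1) : ℕ).toPNat')
  else if (p : ℕ) = j + 1 then ((1 : ℕ+) : NStar) else ∞

theorem prependFun_natAddPNat (j : ℕ) (σ : SeqSpace) (q : ℕ+) :
    prependFun j σ (natAddPNat (j + 1) q) = NStar.shift 1 (σ q) := by
  have := q.pos
  rw [prependFun, natAddPNat_coe, if_pos (by omega), Nat.add_sub_cancel_left, PNat.coe_toPNat']

/-- The sequence `∞, …, ∞, 1, 1 + σ 1, 1 + σ 2, …` starting with `j` times `∞`. -/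
def prepend (j : ℕ) (σ : SeqSpace) : SeqSpace :=
  ⟨prependFun j σ, fun p q hpq h => by
    by_cases hp : j + 1 < p
    · obtain ⟨p, rfl⟩ := exists_natAddPNat hp
      rw [prependFun_natAddPNat] at h ⊢
      by_cases hq : j + 1 < q
      · obtain ⟨q, rfl⟩ := exists_natAddPNat hq
        rw [prependFun_natAddPNat] at h
        exact NStar.shift_eq_infty.mpr
          (σ.2 _ _ (fun h => hpq (by rw [h])) (NStar.shift_injective 1 h))
      · rw [prependFun, if_neg hq] at h
        split_ifs at h
        · exact absurd h (NStar.shift_ne_one _ _)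
        · exact h
    · by_cases hq : j + 1 < q
      · obtain ⟨q, rfl⟩ := exists_natAddPNat hq
        rw [prependFun_natAddPNat, prependFun, if_neg hp] at h
        rw [prependFun, if_neg hp]
        split_ifs at h ⊢
        · exact absurd h.symm (NStar.shift_ne_one _ _)
        · rfl
      · rw [prependFun, if_neg hp, prependFun, if_neg hq] at h
        rw [prependFun, if_neg hp]
        by_cases h1 : (p : ℕ) = j + 1
        · rw [if_pos h1] at h ⊢
          rw [if_neg fun h2 => hpq (PNat.eq (h1.trans h2.symm))] at h
          exact h
        · exact if_neg h1⟩

theorem prepend_of_lt {j : ℕ} {p : ℕ+} (σ : SeqSpace) (h : (p : ℕ) < j + 1) :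
    prepend j σ p = ∞ := by
  change prependFun j σ p = ∞
  rw [prependFun, if_neg (by omega), if_neg (by omega)]

theorem prepend_of_eq {j : ℕ} {p : ℕ+} (σ : SeqSpace) (h : (p : ℕ) = j + 1) :
    prepend j σ p = ((1 : ℕ+) : NStar) := by
  change prependFun j σ p = _
  rw [prependFun, if_neg (by omega), if_pos h]

theorem prepend_natAddPNat (j : ℕ) (σ : SeqSpace) (q : ℕ+) :
    prepend j σ (natAddPNat (j + 1) q) = NStar.shift 1 (σ q) :=
  prependFun_natAddPNat j σ q

theorem lipschitzWith_shift (x : ℕ+) : LipschitzWith (1 / 2) (shift x) := by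
  refine LipschitzWith.of_dist_le_mul fun σ τ => ?_
  rw [dist_eq_D, dist_eq_D]
  refine hasSum_le (fun i => ?_) (summable_D _ _).hasSum ((summable_D σ τ).hasSum.mul_left _)
  rw [← mul_div_assoc]
  gcongr
  simpa using NStar.dist_shift_le x (σ i) (τ i)

/-- The first `j + 1` entries do not depend on the argument. On the others the translation by `1`
gives the factor `1/2`, and the gain from moving to later positions is discarded. -/
theorem lipschitzWith_prepend (j : ℕ) : LipschitzWith (1 / 2) (prepend j) := by
  refine LipschitzWith.of_dist_le_mul fun σ τ => ?_
  rw [dist_eq_D, dist_eq_D]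
  have h0 := ((natAddPNat_injective (j + 1)).hasSum_iff (f := fun i : ℕ+ =>
      dist (prepend j σ i) (prepend j τ i) / 2 ^ (i : ℕ)) (fun x hx => ?_)).mpr
    (summable_D (prepend j σ) (prepend j τ)).hasSum
  · refine hasSum_le (fun q => ?_) h0 ((summable_D σ τ).hasSum.mul_left _)
    rw [Function.comp, prepend_natAddPNat, prepend_natAddPNat, ← mul_div_assoc, natAddPNat_coe]
    gcongr
    · simpa using NStar.dist_shift_le 1 (σ q) (τ q)
    · norm_num
    · omega
  · rcases lt_trichotomy (x : ℕ) (j + 1) with h | h | h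
    · simp [prepend_of_lt _ h]
    · simp [prepend_of_eq _ h]
    · exact absurd (exists_natAddPNat h) hx

end SeqSpace

/-! ### One-step recursions for the limit sequences -/

/-- The sequence `a, f 0, f 1, …`. -/
def seqCons {α : Type*} (a : α) (f : ℕ → α) : ℕ → α
  | 0 => a
  | n + 1 => f n

@[simp] theorem seqCons_zero {α : Type*} (a : α) (f : ℕ → α) : seqCons a f 0 = a := rfl

@[simp] theorem seqCons_succ {α : Type*} (a : α) (f : ℕ → α) (n : ℕ) :
    seqCons a f (n + 1) = f n := rfl

/-- The sequence `f 0 + 1, f 1, f 2, …`. -/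
def incHead (f : ℕ → ℕ+) : ℕ → ℕ+ := seqCons (f 0 + 1) fun n => f (n + 1)

namespace Limit213

theorem partialSum_succ (a : ℕ → ℕ) (n : ℕ) : partialSum a (n + 1) = partialSum a n + a n :=
  Finset.sum_range_succ _ _

@[simp] theorem partialSum_zero (a : ℕ → ℕ) : partialSum a 0 = 0 := rfl

theorem partialSum_seqCons (x : ℕ+) (f : ℕ → ℕ+) (n : ℕ) :
    partialSum (fun j => (seqCons x f j : ℕ+)) (n + 1) = x + partialSum (fun j => f j) n := by
  simp [partialSum, Finset.sum_range_succ', add_comm]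

theorem partialSum_incHead (f : ℕ → ℕ+) (n : ℕ) :
    partialSum (fun j => (incHead f j : ℕ+)) (n + 1) = 1 + partialSum (fun j => f j) (n + 1) := by
  rw [incHead, partialSum_seqCons]
  simp only [partialSum, Finset.sum_range_succ', PNat.add_coe, PNat.one_coe]
  omega

/-- The position of the `(k + 1)`-st value of `∞^{(J)} * I` that is not one of the inserted `∞`. -/
def position (J : ℕ → ℕ) (k : ℕ) : ℕ := partialSum (fun j => J j + 1) (k + 1)

theorem position_strictMono (J : ℕ → ℕ) : StrictMono (position J) := by
  refine strictMono_nat_of_lt_succ fun k => ?_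
  rw [position, position, partialSum_succ _ (k + 1)]
  omega

theorem position_seqCons_zero (j : ℕ) (J : ℕ → ℕ) : position (seqCons j J) 0 = j + 1 := by
  simp [position, partialSum]

theorem position_seqCons_succ (j : ℕ) (J : ℕ → ℕ) (k : ℕ) :
    position (seqCons j J) (k + 1) = j + 1 + position J k := by
  simp only [position, partialSum, Finset.sum_range_succ' _ (k + 1), seqCons_succ, seqCons_zero]
  omega

theorem concat_of_eq {J : ℕ → ℕ} {I : Set ℕ+} (hI : I.Infinite) {p : ℕ+} {k : ℕ}
    (h : (p : ℕ) = position J k) : concat J I hI p = (enum I k : NStar) := by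
  classical
  have hex : ∃ k, (p : ℕ) = partialSum (fun j => J j + 1) (k + 1) := ⟨k, h⟩
  change concatFun J I p = _
  rw [concatFun, dif_pos hex]
  have h1 : (p : ℕ) = position J (Nat.find hex) := Nat.find_spec hex
  rw [(position_strictMono J).injective (h1.symm.trans h)]

theorem concat_of_ne {J : ℕ → ℕ} {I : Set ℕ+} (hI : I.Infinite) {p : ℕ+}
    (h : ∀ k, (p : ℕ) ≠ position J k) : concat J I hI p = ∞ := by
  change concatFun J I p = _
  rw [concatFun, dif_neg]
  rintro ⟨k, hk⟩
  exact h k hk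

theorem enum_eq {I : Set ℕ+} {f : ℕ → ℕ+} (hf : StrictMono f) (h : Set.range f = I) :
    enum I = f := by
  have hI : I.Infinite := h ▸ Set.infinite_range_of_injective hf.injective
  exact (StrictMono.range_inj (enum_strictMono hI) hf).mp (by rw [range_enum hI, h])

theorem concat_shift {J : ℕ → ℕ} {I I' : Set ℕ+} (hI : I.Infinite) (hI' : I'.Infinite) {x : ℕ+}
    (h : I = (x + ·) '' I') : concat J I hI = SeqSpace.shift x (concat J I' hI') := by
  have henum : enum I = fun k => x + enum I' k :=
    enum_eq ((enum_strictMono hI').const_add x) (by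
      rw [h, ← range_enum hI', ← Set.range_comp, range_enum hI']
      rfl)
  refine Subtype.ext (funext fun p => ?_)
  by_cases hp : ∃ k, (p : ℕ) = position J k
  · obtain ⟨k, hk⟩ := hp
    exact (concat_of_eq hI hk).trans (by
      rw [SeqSpace.shift_apply, concat_of_eq hI' hk, henum, NStar.shift_coe])
  · push Not at hp
    exact (concat_of_ne hI hp).trans (by
      rw [SeqSpace.shift_apply, concat_of_ne hI' hp, NStar.shift_infty])

/-- The new least value `1` takes up the new first block of infinities; later values move up by `1`
and later positions by `j + 1`. -/
theorem concat_prepend {J : ℕ → ℕ} {I I' : Set ℕ+} (hI : I.Infinite) (hI' : I'.Infinite) (j : ℕ)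
    (h : I = insert 1 ((1 + ·) '' I')) :
    concat (seqCons j J) I hI = SeqSpace.prepend j (concat J I' hI') := by
  have henum : enum I = seqCons 1 fun k => 1 + enum I' k := by
    refine enum_eq (strictMono_nat_of_lt_succ fun k => ?_) ?_
    · cases k with
      | zero => exact PNat.lt_add_right 1 _
      | succ k => exact add_lt_add_right (enum_strictMono hI' (Nat.lt_succ_self k)) 1
    · rw [h]
      nth_rewrite 2 [← range_enum hI']
      ext v
      simp only [Set.mem_range, Set.mem_insert_iff, Set.mem_image, exists_exists_eq_and]
      constructor
      · rintro ⟨k, rfl⟩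
        cases k with
        | zero => exact Or.inl rfl
        | succ k => exact Or.inr ⟨k, rfl⟩
      · rintro (rfl | ⟨k, rfl⟩)
        · exact ⟨0, rfl⟩
        · exact ⟨k + 1, rfl⟩
  refine Subtype.ext (funext fun p => ?_)
  rcases lt_trichotomy (p : ℕ) (j + 1) with hp | hp | hp
  · refine Eq.trans (concat_of_ne hI fun k hk => ?_) (SeqSpace.prepend_of_lt _ hp).symm
    have := (position_strictMono (seqCons j J)).monotone (Nat.zero_le k)
    rw [position_seqCons_zero] at this
    omega
  · refine Eq.trans (concat_of_eq (k := 0) hI ?_) ?_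
    · rw [position_seqCons_zero, hp]
    · rw [henum]
      exact (SeqSpace.prepend_of_eq _ hp).symm
  · obtain ⟨q, rfl⟩ := exists_natAddPNat hp
    refine Eq.trans ?_ (SeqSpace.prepend_natAddPNat _ _ _).symm
    by_cases hq : ∃ k, (q : ℕ) = position J k
    · obtain ⟨k, hk⟩ := hq
      rw [concat_of_eq hI' hk]
      refine (concat_of_eq (k := k + 1) hI ?_).trans ?_
      · rw [natAddPNat_coe, position_seqCons_succ, hk]
      · rw [henum, NStar.shift_coe]
        rfl
    · push Not at hq
      rw [concat_of_ne hI' hq]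
      refine concat_of_ne hI fun k hk => ?_
      have := q.pos
      rw [natAddPNat_coe] at hk
      cases k with
      | zero => rw [position_seqCons_zero] at hk; omega
      | succ k => exact hq k (by rw [position_seqCons_succ] at hk; omega)

theorem mem_image_add {x v : ℕ+} {I : Set ℕ+} :
    v ∈ (x + ·) '' I ↔ ∃ u ∈ I, (v : ℕ) = x + u := by
  refine exists_congr fun u => and_congr_right fun _ => ?_
  rw [← PNat.coe_inj, PNat.add_coe, eq_comm]

theorem image_add_setOf (x : ℕ+) (a b : ℕ → ℕ) :
    (x + ·) '' {v : ℕ+ | ∃ n, a n + 1 ≤ (v : ℕ) ∧ (v : ℕ) ≤ b n} =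
      {v : ℕ+ | ∃ n, x + a n + 1 ≤ (v : ℕ) ∧ (v : ℕ) ≤ x + b n} := by
  ext v
  rw [mem_image_add]
  constructor
  · rintro ⟨u, ⟨n, h1, h2⟩, h⟩
    exact ⟨n, by omega, by omega⟩
  · rintro ⟨n, h1, h2⟩
    have hv : ((v - x : ℕ).toPNat' : ℕ) = v - x := by
      rw [Nat.toPNat'_coe, if_pos (by omega)]
    exact ⟨(v - x : ℕ).toPNat', ⟨n, by omega, by omega⟩, by omega⟩

theorem insert_one_image_add_setOf (a b : ℕ → ℕ) (ha : a 0 = 0) :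
    insert 1 ((1 + ·) '' {v : ℕ+ | ∃ n, a n + 1 ≤ (v : ℕ) ∧ (v : ℕ) ≤ b n}) =
      {v : ℕ+ | (v : ℕ) ≤ 1 + b 0 ∨ ∃ n, 1 + a (n + 1) + 1 ≤ (v : ℕ) ∧ (v : ℕ) ≤ 1 + b (n + 1)} := by
  ext v
  have := v.pos
  rw [image_add_setOf, Set.mem_insert_iff, ← PNat.coe_inj, PNat.one_coe]
  constructor
  · rintro (h | ⟨n, h⟩)
    · exact Or.inl (by omega)
    · cases n with
      | zero => exact Or.inl h.2
      | succ n => exact Or.inr ⟨n, h⟩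
  · rintro (h | ⟨n, h⟩)
    · by_cases h1 : (v : ℕ) = 1
      · exact Or.inl h1
      · exact Or.inr ⟨0, by omega⟩
    · exact Or.inr ⟨n + 1, h⟩

/-- The first interval grows by one element at its lower end and everything else moves up by one:
state 1 continues. -/
theorem valueSet1_incHead (Xhat Y1 Y2 : ℕ → ℕ+) :
    valueSet1 Xhat (incHead Y1) Y2 = insert 1 ((1 + ·) '' valueSet1 Xhat Y1 Y2) := by
  unfold valueSet1
  rw [insert_one_image_add_setOf _ _ (by simp)]
  ext v
  have := v.pos
  simp only [Set.mem_ofPred_eq]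
  constructor
  · rintro ⟨n, h⟩
    cases n with
    | zero =>
      left
      have := h.2
      simp only [partialSum_incHead, partialSum_zero] at this ⊢
      omega
    | succ n =>
      right
      refine ⟨n, ?_⟩
      simp only [partialSum_incHead] at h
      omega
  · rintro (h | ⟨n, h⟩)
    · refine ⟨0, ?_⟩
      simp only [partialSum_incHead, partialSum_zero] at h ⊢
      omega
    · refine ⟨n + 1, ?_⟩
      simp only [partialSum_incHead]
      omega

/-- The first interval is `{1}` alone, so after it the next gap begins, as in `valueSet0`: state 1
passes to state 0. -/
theorem valueSet1_seqCons_one (Xhat Y1 Y2 : ℕ → ℕ+) :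
    valueSet1 Xhat (seqCons 1 Y1) Y2 = insert 1 ((1 + ·) '' valueSet0 Xhat Y1 Y2) := by
  unfold valueSet1 valueSet0
  rw [image_add_setOf]
  ext v
  have := v.pos
  simp only [Set.mem_ofPred_eq, Set.mem_insert_iff, ← PNat.coe_inj, PNat.one_coe]
  constructor
  · rintro ⟨n, h⟩
    cases n with
    | zero =>
      left
      have := h.2
      simp only [partialSum_seqCons, partialSum_zero, PNat.one_coe] at this ⊢
      omega
    | succ n =>
      right
      refine ⟨n, ?_⟩
      simp only [partialSum_seqCons, PNat.one_coe] at h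
      omega
  · rintro (h | ⟨n, h⟩)
    · refine ⟨0, ?_⟩
      simp only [partialSum_seqCons, partialSum_zero, PNat.one_coe]
      omega
    · refine ⟨n + 1, ?_⟩
      simp only [partialSum_seqCons, PNat.one_coe]
      omega

/-- The initial gap has one more `Xhat`-summand, namely `x`; once it is removed a gap still comes
first: state 0 continues. -/
theorem valueSet0_seqCons_incHead (x : ℕ+) (Xhat Y1 Y2 : ℕ → ℕ+) :
    valueSet0 (seqCons x Xhat) Y1 (incHead Y2) = (x + ·) '' valueSet0 Xhat Y1 Y2 := by
  unfold valueSet0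
  rw [image_add_setOf]
  ext v
  simp only [Set.mem_ofPred_eq]
  refine exists_congr fun n => ?_
  rw [partialSum_incHead, add_comm 1, partialSum_seqCons]
  omega

/-- The initial gap consists of the single summand `x`; an interval follows it directly: state 0
passes to state 1. -/
theorem valueSet0_seqCons_seqCons (x : ℕ+) (Xhat Y1 Y2 : ℕ → ℕ+) :
    valueSet0 (seqCons x Xhat) Y1 (seqCons 1 Y2) = (x + ·) '' valueSet1 Xhat Y1 Y2 := by
  unfold valueSet0 valueSet1
  rw [image_add_setOf]
  ext v
  simp only [Set.mem_ofPred_eq]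
  refine exists_congr fun n => ?_
  rw [partialSum_seqCons, PNat.one_coe, add_comm 1, partialSum_seqCons]
  omega

/-- `∞^{(J)} * I^{(1)}`. -/
noncomputable def limit1 (X : ℕ → ℕ) (Xhat Y1 Y2 : ℕ → ℕ+) : SeqSpace :=
  concat X (valueSet1 Xhat Y1 Y2) (valueSet1_infinite Xhat Y1 Y2)

/-- `∞^{(J)} * I^{(0)}`. -/
noncomputable def limit0 (X : ℕ → ℕ) (Xhat Y1 Y2 : ℕ → ℕ+) : SeqSpace :=
  concat X (valueSet0 Xhat Y1 Y2) (valueSet0_infinite Xhat Y1 Y2)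

theorem limit1_incHead (j : ℕ) (X : ℕ → ℕ) (Xhat Y1 Y2 : ℕ → ℕ+) :
    limit1 (seqCons j X) Xhat (incHead Y1) Y2 = SeqSpace.prepend j (limit1 X Xhat Y1 Y2) :=
  concat_prepend _ _ _ (valueSet1_incHead _ _ _)

theorem limit1_seqCons_one (j : ℕ) (X : ℕ → ℕ) (Xhat Y1 Y2 : ℕ → ℕ+) :
    limit1 (seqCons j X) Xhat (seqCons 1 Y1) Y2 = SeqSpace.prepend j (limit0 X Xhat Y1 Y2) :=
  concat_prepend _ _ _ (valueSet1_seqCons_one _ _ _)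

theorem limit0_incHead (x : ℕ+) (X : ℕ → ℕ) (Xhat Y1 Y2 : ℕ → ℕ+) :
    limit0 X (seqCons x Xhat) Y1 (incHead Y2) = SeqSpace.shift x (limit0 X Xhat Y1 Y2) :=
  concat_shift _ _ (valueSet0_seqCons_incHead _ _ _ _)

theorem limit0_seqCons_one (x : ℕ+) (X : ℕ → ℕ) (Xhat Y1 Y2 : ℕ → ℕ+) :
    limit0 X (seqCons x Xhat) Y1 (seqCons 1 Y2) = SeqSpace.shift x (limit1 X Xhat Y1 Y2) :=
  concat_shift _ _ (valueSet0_seqCons_seqCons _ _ _ _)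

/-- All increments are positive, so the gap after the first interval is not empty. -/
theorem exists_notMem_valueSet1 (Xhat Y1 Y2 : ℕ → ℕ+) : ∃ v, v ∉ valueSet1 Xhat Y1 Y2 := by
  refine ⟨Y1 0 + 1, ?_⟩
  rintro ⟨n, h1, h2⟩
  rw [PNat.add_coe, PNat.one_coe] at h1 h2
  cases n with
  | zero => simp [partialSum] at h2
  | succ n =>
    have h3 : (Y1 0 : ℕ) ≤ partialSum (fun j => Y1 j) (n + 1) := by
      rw [partialSum, Finset.sum_range_succ']
      exact Nat.le_add_left _ _
    have h4 := (le_partialSum Y2 (n + 1)).trans (le_partialSum Xhat _)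
    omega

theorem exists_notMem_valueSet0 (Xhat Y1 Y2 : ℕ → ℕ+) : ∃ v, v ∉ valueSet0 Xhat Y1 Y2 := by
  refine ⟨1, ?_⟩
  rintro ⟨n, h1, h2⟩
  have h4 := (le_partialSum Y2 (n + 1)).trans (le_partialSum Xhat _)
  rw [PNat.one_coe] at h1
  omega

theorem concat_notMem_surjections {J : ℕ → ℕ} {I : Set ℕ+} (hI : I.Infinite) (h : ∃ v, v ∉ I) :
    concat J I hI ∉ SeqSpace.surjections := by
  intro hs
  obtain ⟨v, hv⟩ := h
  obtain ⟨p, hp⟩ := hs (v : NStar)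
  by_cases hk : ∃ k, (p : ℕ) = position J k
  · obtain ⟨k, hk⟩ := hk
    refine hv ?_
    rw [← OnePoint.coe_injective ((concat_of_eq hI hk).symm.trans hp), ← range_enum hI]
    exact ⟨k, by rw [range_enum hI]⟩
  · push Not at hk
    exact OnePoint.coe_ne_infty v (hp.symm.trans (concat_of_ne hI hk))

theorem concat_notMem_injections {J : ℕ → ℕ} {I : Set ℕ+} (hI : I.Infinite) (h : ∃ k, J k ≠ 0) :
    concat J I hI ∉ SeqSpace.injections := by
  rintro ⟨f, -, hf⟩
  have hpos : ∀ p : ℕ+, ∃ k, (p : ℕ) = position J k := by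
    intro p
    by_contra hp
    push Not at hp
    exact OnePoint.coe_ne_infty _ ((hf p).symm.trans (concat_of_ne hI hp))
  -- Without any `∞` the positions exhaust the positive integers, and a strictly increasing
  -- enumeration of them is unique; it leaves no room for a nonempty block.
  have hid : position J = fun k => k + 1 := by
    refine (StrictMono.range_inj (position_strictMono J)
      (strictMono_id.add_const 1 : StrictMono fun k : ℕ => k + 1)).mp ?_
    ext m
    constructor
    · rintro ⟨k, rfl⟩
      refine ⟨position J k - 1, Nat.sub_add_cancel ?_⟩
      rw [position, partialSum_succ]
      omega
    · rintro ⟨k, rfl⟩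
      obtain ⟨l, hl⟩ := hpos k.succPNat
      exact ⟨l, by simpa using hl.symm⟩
  obtain ⟨k, hk⟩ := h
  cases k with
  | zero =>
    have := congrFun hid 0
    simp only [position, partialSum_succ, partialSum_zero] at this
    omega
  | succ k =>
    have h1 := congrFun hid (k + 1)
    have h2 := congrFun hid k
    rw [position, partialSum_succ] at h1
    rw [position] at h2
    omega

end Limit213

/-! ### Splitting a `213`-avoiding permutation at its minimum -/

namespace PatternAvoidance

theorem contains_tau213_iff {n : ℕ} (σ : Equiv.Perm (Fin n)) :
    Contains σ tau213 ↔ ∃ a b c, a < b ∧ b < c ∧ σ b < σ a ∧ σ a < σ c := by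
  constructor
  · rintro ⟨i, hi, h⟩
    exact ⟨i 0, i 1, i 2, hi (by decide), hi (by decide), (h 1 0).mpr (by decide),
      (h 0 2).mpr (by decide)⟩
  · rintro ⟨a, b, c, hab, hbc, h1, h2⟩
    refine ⟨![a, b, c], ?_, ?_⟩
    · rw [Fin.strictMono_iff_lt_succ]
      intro i
      fin_cases i
      · exact hab
      · exact hbc
    · have e0 : tau213 0 = 1 := by decide
      have e1 : tau213 1 = 0 := by decide
      have e2 : tau213 2 = 2 := by decide
      have h3 := h1.trans h2
      have := h1.not_gt
      have := h2.not_gt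
      have := h3.not_gt
      intro j k
      fin_cases j <;> fin_cases k <;> simp [e0, e1, e2, *]

theorem mem_avoiders_iff {n : ℕ} {σ : Equiv.Perm (Fin n)} :
    σ ∈ avoiders n ↔ ∀ a b c, a < b → b < c → σ b < σ a → σ c ≤ σ a := by
  classical
  simp only [avoiders, Finset.mem_filter, Finset.mem_univ, true_and, contains_tau213_iff]
  push Not
  rfl

section Glue

variable {j k n : ℕ} (h : j + k = n) (τ : Equiv.Perm (Fin j)) (ρ : Equiv.Perm (Fin k))

/-- The values of the permutation `(k + 1 + τ), 0, (1 + ρ)`. -/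
def glueFun (p : Fin (n + 1)) : Fin (n + 1) :=
  if hp : (p : ℕ) < j then ⟨τ ⟨p, hp⟩ + (k + 1), by omega⟩
  else if hp' : (p : ℕ) = j then 0
  else ⟨ρ ⟨p - (j + 1), by omega⟩ + 1, by omega⟩

theorem glueFun_of_lt {p : Fin (n + 1)} (hp : (p : ℕ) < j) :
    (glueFun h τ ρ p : ℕ) = τ ⟨p, hp⟩ + (k + 1) := by
  rw [glueFun, dif_pos hp]

theorem glueFun_of_eq {p : Fin (n + 1)} (hp : (p : ℕ) = j) : (glueFun h τ ρ p : ℕ) = 0 := by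
  rw [glueFun, dif_neg (by omega), dif_pos hp, Fin.val_zero]

theorem glueFun_of_gt {p : Fin (n + 1)} {q : Fin k} (hp : (p : ℕ) = j + 1 + q) :
    (glueFun h τ ρ p : ℕ) = ρ q + 1 := by
  rw [glueFun, dif_neg (by omega), dif_neg (by omega)]
  simp only [Nat.add_right_cancel_iff]
  congr 3
  omega

theorem glueFun_cases (p : Fin (n + 1)) :
    (∃ q : Fin j, (p : ℕ) = q ∧ (glueFun h τ ρ p : ℕ) = τ q + (k + 1)) ∨
    ((p : ℕ) = j ∧ (glueFun h τ ρ p : ℕ) = 0) ∨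
    ∃ q : Fin k, (p : ℕ) = j + 1 + q ∧ (glueFun h τ ρ p : ℕ) = ρ q + 1 := by
  rcases lt_trichotomy (p : ℕ) j with hp | hp | hp
  · exact Or.inl ⟨⟨p, hp⟩, rfl, glueFun_of_lt h τ ρ hp⟩
  · exact Or.inr (Or.inl ⟨hp, glueFun_of_eq h τ ρ hp⟩)
  · have hq : (p : ℕ) = j + 1 + (⟨p - (j + 1), by omega⟩ : Fin k) := by simp only; omega
    exact Or.inr (Or.inr ⟨_, hq, glueFun_of_gt h τ ρ hq⟩)

theorem glueFun_injective : Function.Injective (glueFun h τ ρ) := by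
  intro p p' hpp
  have hv := congrArg Fin.val hpp
  rcases glueFun_cases h τ ρ p with ⟨q, hp, e⟩ | ⟨hp, e⟩ | ⟨q, hp, e⟩ <;>
  rcases glueFun_cases h τ ρ p' with ⟨q', hp', e'⟩ | ⟨hp', e'⟩ | ⟨q', hp', e'⟩ <;>
  rw [e, e'] at hv
  · have := τ.injective (Fin.ext (Nat.add_right_cancel hv))
    exact Fin.ext (by rw [hp, hp', this])
  · omega
  · have := (ρ q').2
    omega
  · omega
  · exact Fin.ext (by omega)
  · omega
  · have := (ρ q).2
    omega
  · omega
  · have := ρ.injective (Fin.ext (Nat.add_right_cancel hv))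
    exact Fin.ext (by rw [hp, hp', this])

/-- The permutation `(k + 1 + τ), 0, (1 + ρ)`. -/
noncomputable def glue : Equiv.Perm (Fin (n + 1)) :=
  Equiv.ofBijective (glueFun h τ ρ) (Finite.injective_iff_bijective.mp (glueFun_injective h τ ρ))

theorem glue_apply (p : Fin (n + 1)) : glue h τ ρ p = glueFun h τ ρ p := rfl

variable {τ ρ}

/-- The blocks decrease in value from left to right. If `a` is in the left block, the larger entry
at `c` is there too, hence also `b` between them; if `a` is in the right block, so are `b` and `c`;
and nothing lies below the minimum. Only a pattern inside one block could survive. -/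
theorem glue_mem_avoiders (hτ : τ ∈ avoiders j) (hρ : ρ ∈ avoiders k) :
    glue h τ ρ ∈ avoiders (n + 1) := by
  rw [mem_avoiders_iff] at *
  intro a b c hab hbc h1
  by_contra! h2
  simp only [glue_apply, Fin.lt_def] at h1 h2 hab hbc
  rcases glueFun_cases h τ ρ a with ⟨a', ha, ea⟩ | ⟨ha, ea⟩ | ⟨a', ha, ea⟩ <;>
  rcases glueFun_cases h τ ρ b with ⟨b', hb, eb⟩ | ⟨hb, eb⟩ | ⟨b', hb, eb⟩ <;>
  rcases glueFun_cases h τ ρ c with ⟨c', hc, ec⟩ | ⟨hc, ec⟩ | ⟨c', hc, ec⟩ <;>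
  rw [ea] at h1 h2 <;> rw [eb] at h1 <;> rw [ec] at h2 <;> try omega
  · have := hτ a' b' c' (Fin.lt_def.mpr (by omega)) (Fin.lt_def.mpr (by omega))
      (Fin.lt_def.mpr (by omega))
    rw [Fin.le_def] at this
    omega
  · have := hρ a' b' c' (Fin.lt_def.mpr (by omega)) (Fin.lt_def.mpr (by omega))
      (Fin.lt_def.mpr (by omega))
    rw [Fin.le_def] at this
    omega

end Glue

theorem eq_of_glue_eq {n : ℕ} {j j' : Fin (n + 1)} {k k' : ℕ} (h : j + k = n) (h' : j' + k' = n)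
    {τ : Equiv.Perm (Fin j)} {ρ : Equiv.Perm (Fin k)} {τ' : Equiv.Perm (Fin j')}
    {ρ' : Equiv.Perm (Fin k')} (he : glue h τ ρ = glue h' τ' ρ') :
    j = j' := by
  have h1 : (glueFun h τ ρ j : ℕ) = 0 := glueFun_of_eq h τ ρ rfl
  have h2 : (glueFun h' τ' ρ' j' : ℕ) = 0 := glueFun_of_eq h' τ' ρ' rfl
  refine (glue h τ ρ).injective (Fin.ext ?_)
  rw [glue_apply, h1, he, glue_apply, h2]

theorem glue_injective {j k n : ℕ} (h : j + k = n) {τ τ' : Equiv.Perm (Fin j)}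
    {ρ ρ' : Equiv.Perm (Fin k)} (he : glue h τ ρ = glue h τ' ρ') : τ = τ' ∧ ρ = ρ' := by
  have he' : ∀ p, (glueFun h τ ρ p : ℕ) = glueFun h τ' ρ' p := fun p =>
    congrArg Fin.val (DFunLike.congr_fun he p)
  constructor
  · ext q
    have := he' ⟨q, by omega⟩
    rw [glueFun_of_lt h τ ρ q.2, glueFun_of_lt h τ' ρ' q.2] at this
    simpa using this
  · ext q
    have := he' ⟨j + 1 + q, by omega⟩
    rw [glueFun_of_gt h τ ρ (q := q) rfl, glueFun_of_gt h τ' ρ' (q := q) rfl] at this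
    simpa using this

/-- A value is the number of smaller entries; this turns comparisons between blocks into bounds on
values. -/
theorem card_filter_apply_lt {n : ℕ} (σ : Equiv.Perm (Fin n)) (p : Fin n) :
    (Finset.univ.filter fun q => σ q < σ p).card = σ p := by
  rw [← Fin.card_Iio (σ p), ← Finset.card_map σ.toEmbedding]
  congr 1
  ext q
  simp

theorem exists_glue_eq {n : ℕ} {σ : Equiv.Perm (Fin (n + 1))} (hσ : σ ∈ avoiders (n + 1))
    {j : Fin (n + 1)} {k : ℕ} (h : j + k = n) (hj : σ j = 0) :
    ∃ τ ∈ avoiders j, ∃ ρ ∈ avoiders k, glue h τ ρ = σ := by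
  rw [mem_avoiders_iff] at hσ
  have hpos : ∀ {p}, p ≠ j → σ j < σ p := by
    intro p hp
    rw [hj]
    exact Fin.pos_iff_ne_zero.mpr fun h0 => hp (σ.injective (h0.trans hj.symm))
  -- Otherwise the entries at `p`, `j`, `q` would form a `213`, since the one at `j` is the minimum.
  have hcross : ∀ {p q}, p < j → j < q → σ q < σ p := fun {p q} hp hq =>
    lt_of_le_of_ne (hσ p j q hp hq (hpos hp.ne)) fun he => (hp.trans hq).ne' (σ.injective he)
  -- The `k + 1` entries from position `j` on are all smaller than the entry at `p`.
  have hge : ∀ p, p < j → k + 1 ≤ (σ p : ℕ) := by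
    intro p hp
    rw [← card_filter_apply_lt σ p]
    have hc : (Finset.Ici j).card = k + 1 := by rw [Fin.card_Ici]; omega
    rw [← hc]
    refine Finset.card_le_card fun q hq => ?_
    rw [Finset.mem_Ici] at hq
    rw [Finset.mem_filter]
    refine ⟨Finset.mem_univ _, ?_⟩
    rcases hq.eq_or_lt with rfl | hq
    · exact hpos hp.ne
    · exact hcross hp hq
  -- The smaller entries all stand in `Finset.Ici j`, which also contains `p` itself, so the
  -- inclusion is strict.
  have hle : ∀ p, j < p → (σ p : ℕ) < k + 1 := by
    intro p hp
    rw [← card_filter_apply_lt σ p]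
    have hc : (Finset.Ici j).card = k + 1 := by rw [Fin.card_Ici]; omega
    rw [← hc]
    refine Finset.card_lt_card ((Finset.ssubset_iff_of_subset fun q hq => ?_).mpr
      ⟨p, Finset.mem_Ici.mpr hp.le, fun hq => lt_irrefl _ (Finset.mem_filter.mp hq).2⟩)
    rw [Finset.mem_filter] at hq
    rw [Finset.mem_Ici]
    by_contra! hqj
    exact hq.2.not_gt (hcross hqj hp)
  have hpos' : ∀ p, j < p → 0 < (σ p : ℕ) := by
    intro p hp
    have := Fin.lt_def.mp (hpos hp.ne')
    omega
  have hL : ∀ q : Fin j, (⟨q, by omega⟩ : Fin (n + 1)) < j := fun q => Fin.lt_def.mpr q.2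
  have hR : ∀ q : Fin k, j < (⟨j + 1 + q, by omega⟩ : Fin (n + 1)) := fun q =>
    Fin.lt_def.mpr (by simp only; omega)
  let f : Fin j → Fin j := fun q => ⟨σ ⟨q, by omega⟩ - (k + 1), by
    have := (σ ⟨q, by omega⟩).2; have := hge _ (hL q); omega⟩
  let g : Fin k → Fin k := fun q => ⟨σ ⟨j + 1 + q, by omega⟩ - 1, by
    have := hle _ (hR q); have := hpos' _ (hR q); omega⟩
  have hf : ∀ q : Fin j, (σ ⟨q, by omega⟩ : ℕ) = f q + (k + 1) := fun q => by
    have := hge _ (hL q)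
    simp only [f]
    omega
  have hg : ∀ q : Fin k, (σ ⟨j + 1 + q, by omega⟩ : ℕ) = g q + 1 := fun q => by
    have := hpos' _ (hR q)
    simp only [g]
    omega
  have hfi : Function.Injective f := by
    intro q q' hq
    have h1 := hf q
    rw [hq, ← hf q'] at h1
    simpa [Fin.ext_iff] using σ.injective (Fin.ext h1)
  have hgi : Function.Injective g := by
    intro q q' hq
    have h1 := hg q
    rw [hq, ← hg q'] at h1
    simpa [Fin.ext_iff] using σ.injective (Fin.ext h1)
  refine ⟨Equiv.ofBijective f (Finite.injective_iff_bijective.mp hfi), ?_,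
    Equiv.ofBijective g (Finite.injective_iff_bijective.mp hgi), ?_, ?_⟩
  · rw [mem_avoiders_iff]
    intro a b c hab hbc h1
    have := hσ ⟨a, by omega⟩ ⟨b, by omega⟩ ⟨c, by omega⟩ hab hbc
    simp only [Fin.lt_def, Fin.le_def, hf] at this
    simp only [Equiv.ofBijective_apply, Fin.lt_def, Fin.le_def] at h1 ⊢
    omega
  · rw [mem_avoiders_iff]
    intro a b c hab hbc h1
    have := hσ ⟨j + 1 + a, by omega⟩ ⟨j + 1 + b, by omega⟩ ⟨j + 1 + c, by omega⟩
      (Fin.lt_def.mpr (Nat.add_lt_add_left hab _)) (Fin.lt_def.mpr (Nat.add_lt_add_left hbc _))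
    simp only [Fin.lt_def, Fin.le_def, hg] at this
    simp only [Equiv.ofBijective_apply, Fin.lt_def, Fin.le_def] at h1 ⊢
    omega
  · refine Equiv.ext fun p => Fin.ext ?_
    rw [glue_apply]
    rcases glueFun_cases h (Equiv.ofBijective f (Finite.injective_iff_bijective.mp hfi))
      (Equiv.ofBijective g (Finite.injective_iff_bijective.mp hgi)) p with
      ⟨q, hp, e⟩ | ⟨hp, e⟩ | ⟨q, hp, e⟩
    · rw [e, Equiv.ofBijective_apply, ← hf]
      congr 2
      exact Fin.ext hp.symm
    · rw [e, Fin.ext hp, hj, Fin.val_zero]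
    · rw [e, Equiv.ofBijective_apply, ← hg]
      congr 2
      exact Fin.ext hp.symm

theorem add_sub_val {n : ℕ} (j : Fin (n + 1)) : (j : ℕ) + (n - j) = n := by omega

/-- The splitting is a bijection: `j` is recovered as the position of `0`, the blocks as the
restrictions. It serves both the Catalan count and the recursion for averages. -/
theorem sum_avoiders_succ {M : Type*} [AddCommMonoid M] (n : ℕ)
    (F : Equiv.Perm (Fin (n + 1)) → M) :
    ∑ σ ∈ avoiders (n + 1), F σ = ∑ j : Fin (n + 1), ∑ τ ∈ avoiders j, ∑ ρ ∈ avoiders (n - j),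
      F (glue (add_sub_val j) τ ρ) := by
  simp_rw [← Finset.sum_product']
  rw [Finset.sum_sigma']
  symm
  refine Finset.sum_bij (fun x _ => glue (add_sub_val x.1) x.2.1 x.2.2) ?_ ?_ ?_ ?_
  · intro x hx
    rw [Finset.mem_sigma, Finset.mem_product] at hx
    exact glue_mem_avoiders _ hx.2.1 hx.2.2
  · rintro ⟨j, τ, ρ⟩ - ⟨j', τ', ρ'⟩ - he
    obtain rfl := eq_of_glue_eq _ _ he
    obtain ⟨rfl, rfl⟩ := glue_injective _ he
    rfl
  · intro σ hσ
    obtain ⟨τ, hτ, ρ, hρ, he⟩ := exists_glue_eq hσ (add_sub_val (σ.symm 0)) (by simp)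
    exact ⟨⟨σ.symm 0, τ, ρ⟩, by simp [hτ, hρ], he⟩
  · intro x hx
    rfl

theorem card_avoiders (n : ℕ) : (avoiders n).card = catalan n := by
  induction n using Nat.strong_induction_on with
  | _ n ih =>
    cases n with
    | zero =>
      rw [catalan_zero]
      refine le_antisymm ?_ (Finset.card_pos.mpr (avoiders_nonempty 0))
      exact (Finset.card_le_univ _).trans (by simp)
    | succ n =>
      rw [Finset.card_eq_sum_ones, sum_avoiders_succ, catalan_succ]
      refine Finset.sum_congr rfl fun j _ => ?_
      rw [← ih j (by omega), ← ih (n - j) (by omega)]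
      simp

theorem extend_of_le {n : ℕ} (σ : Equiv.Perm (Fin n)) {p : ℕ+} (i : Fin n) (h : (p : ℕ) = i + 1) :
    (extend σ p : ℕ) = σ i + 1 := by
  have hp : p.natPred = i := by rw [PNat.natPred, h, Nat.add_sub_cancel]
  rw [extend, dif_pos (hp ▸ i.2), Nat.succPNat_coe, Nat.succ_eq_add_one]
  simp only [hp]

theorem extend_of_gt {n : ℕ} (σ : Equiv.Perm (Fin n)) {p : ℕ+} (h : n < (p : ℕ)) :
    extend σ p = p := by
  rw [extend, dif_neg]
  rw [PNat.natPred]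
  omega

/-- When `k` is large, the left block has values above `k` and is nearly `∞`. The minimum and the
right block agree exactly, and past them both sequences have values above `k`. -/
theorem dist_glue_prepend {j k n : ℕ} (h : j + k = n) (τ : Equiv.Perm (Fin j))
    (ρ : Equiv.Perm (Fin k)) :
    dist (toSeqSpace (glue h τ ρ)) (SeqSpace.prepend j (toSeqSpace ρ)) ≤ 4 * (1 / 2) ^ k := by
  have key : ∀ p : ℕ+, dist (toSeqSpace (glue h τ ρ) p) (SeqSpace.prepend j (toSeqSpace ρ) p) ≤
      2 * (1 / 2) ^ k := by
    intro p
    change dist ((extend (glue h τ ρ) p : ℕ+) : NStar) _ ≤ _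
    rcases lt_trichotomy (p : ℕ) (j + 1) with hp | hp | hp
    · rw [SeqSpace.prepend_of_lt _ hp]
      refine NStar.dist_le_of_weight_le (NStar.weight_coe_le ?_) (by simp)
      have hpos := p.pos
      rw [extend_of_le _ (⟨p - 1, by omega⟩ : Fin (n + 1)) (by simp only; omega), glue_apply,
        glueFun_of_lt h τ ρ (by simp only; omega)]
      omega
    · rw [SeqSpace.prepend_of_eq _ hp]
      have : extend (glue h τ ρ) p = 1 := PNat.eq (by
        rw [extend_of_le _ (⟨j, by omega⟩ : Fin (n + 1)) hp, glue_apply, glueFun_of_eq h τ ρ rfl]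
        rfl)
      rw [this, dist_self]
      positivity
    · obtain ⟨q, rfl⟩ := exists_natAddPNat hp
      have hpos := q.pos
      rw [SeqSpace.prepend_natAddPNat]
      change dist _ (NStar.shift 1 ((extend ρ q : ℕ+) : NStar)) ≤ _
      rw [NStar.shift_coe]
      by_cases hq : (q : ℕ) ≤ k
      · have : extend (glue h τ ρ) (natAddPNat (j + 1) q) = 1 + extend ρ q := PNat.eq (by
          rw [extend_of_le _ (⟨j + 1 + (q - 1), by omega⟩ : Fin (n + 1))
            (by simp only [natAddPNat_coe]; omega), glue_apply,
            glueFun_of_gt h τ ρ (q := ⟨q - 1, by omega⟩) rfl, PNat.add_coe, PNat.one_coe,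
            extend_of_le ρ ⟨q - 1, by omega⟩ (by simp only; omega)]
          omega)
        rw [this, dist_self]
        positivity
      · refine NStar.dist_le_of_weight_le (NStar.weight_coe_le ?_) (NStar.weight_coe_le ?_)
        · rw [extend_of_gt _ (by rw [natAddPNat_coe]; omega), natAddPNat_coe]
          omega
        · rw [extend_of_gt _ (by omega), PNat.add_coe, PNat.one_coe]
          omega
  -- The bound `key` is uniform in the position; cutting at `k` adds a second `2 · (1/2)^k`.
  refine (SeqSpace.dist_le_add k (fun p _ => key p) (by positivity)).trans (le_of_eq (by ring))

/-- When `j` is large, the first `j` entries agree exactly and the remaining positions carry little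
weight in `D`. -/
theorem dist_glue_shift {j k n : ℕ} (h : j + k = n) (τ : Equiv.Perm (Fin j))
    (ρ : Equiv.Perm (Fin k)) :
    dist (toSeqSpace (glue h τ ρ)) (SeqSpace.shift k.succPNat (toSeqSpace τ)) ≤
      4 * (1 / 2) ^ j := by
  refine (SeqSpace.dist_le_add j (ε := 0) (fun p hp => ?_) le_rfl).trans ?_
  · have hpos := p.pos
    have : extend (glue h τ ρ) p = k.succPNat + extend τ p := PNat.eq (by
      rw [extend_of_le _ (⟨p - 1, by omega⟩ : Fin (n + 1)) (by simp only; omega), glue_apply,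
        glueFun_of_lt h τ ρ (by simp only; omega), PNat.add_coe, Nat.succPNat_coe,
        extend_of_le τ ⟨p - 1, by omega⟩ (by simp only; omega)]
      dsimp only
      omega)
    change dist ((extend (glue h τ ρ) p : ℕ+) : NStar)
      (NStar.shift k.succPNat ((extend τ p : ℕ+) : NStar)) ≤ 0
    rw [this, NStar.shift_coe, dist_self]
  · have : 0 ≤ (1 / 2 : ℝ) ^ j := by positivity
    linarith

/-- The average of `f` over the `213`-avoiding permutations of length `n`. -/
noncomputable def average (n : ℕ) (f : SeqSpace → ℝ) : ℝ :=
  (∑ σ ∈ avoiders n, f (toSeqSpace σ)) / catalan n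

theorem integral_mu213 (n : ℕ) (f : SeqSpace → ℝ) (hf : Measurable f) :
    ∫ σ, f σ ∂(mu213 n : Measure SeqSpace) = average n f := by
  let _ : MeasurableSpace (Equiv.Perm (Fin n)) := ⊤
  change ∫ σ, f σ ∂((PMF.uniformOfFinset (avoiders n) (avoiders_nonempty n)).map
    toSeqSpace).toMeasure = _
  rw [← PMF.toMeasure_map toSeqSpace _ (measurable_of_finite _),
    integral_map (measurable_of_finite _).aemeasurable hf.aestronglyMeasurable, PMF.integral_eq_sum,
    average, Finset.sum_div, ← Finset.sum_subset (Finset.subset_univ (avoiders n))]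
  · refine Finset.sum_congr rfl fun σ hσ => ?_
    rw [PMF.uniformOfFinset_apply_of_mem _ hσ, card_avoiders]
    simp [div_eq_inv_mul]
  · intro σ _ hσ
    rw [PMF.uniformOfFinset_apply_of_notMem _ hσ]
    simp

end PatternAvoidance

/-! ### Conditioning IID sequences on their first term -/

section Cons

variable {α : Type*} [MeasurableSpace α]

theorem measurable_seqCons : Measurable fun x : α × (ℕ → α) => seqCons x.1 x.2 := by
  refine measurable_pi_lambda _ fun n => ?_
  cases n with
  | zero => exact measurable_fst
  | succ n => exact (measurable_pi_apply n).comp measurable_snd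

theorem map_seqCons_infinitePi (μ : Measure α) [IsProbabilityMeasure μ] :
    (μ.prod (Measure.infinitePi fun _ : ℕ => μ)).map (fun x => seqCons x.1 x.2) =
      Measure.infinitePi fun _ : ℕ => μ := by
  classical
  refine Measure.eq_infinitePi _ fun s t ht => ?_
  obtain ⟨N, hN⟩ : ∃ N, s ⊆ Finset.range (N + 1) :=
    ⟨s.sup id, fun i hi => Finset.mem_range.mpr (Nat.lt_succ_of_le (Finset.le_sup (f := id) hi))⟩
  -- The cylinder is padded with `Set.univ` to an initial segment of indices, from which the first
  -- coordinate can be split off.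
  set t' : ℕ → Set α := fun i => if i ∈ s then t i else Set.univ with ht'
  have hmeas : ∀ i, MeasurableSet (t' i) := fun i => by
    by_cases hi : i ∈ s
    · simpa only [ht', if_pos hi] using ht i
    · simp only [ht', if_neg hi, MeasurableSet.univ]
  have hpi : Set.pi (s : Set ℕ) t = Set.pi (Finset.range (N + 1) : Set ℕ) t' := by
    ext f
    simp only [Set.mem_pi, Finset.mem_coe]
    constructor
    · intro h i _
      by_cases hi : i ∈ s
      · simpa only [ht', if_pos hi] using h i hi
      · simp only [ht', if_neg hi, Set.mem_univ]
    · intro h i hi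
      simpa only [ht', if_pos hi] using h i (hN hi)
  have hprod : ∏ i ∈ s, μ (t i) = ∏ i ∈ Finset.range (N + 1), μ (t' i) := by
    rw [← Finset.prod_subset hN fun i _ hi => by simp only [ht', if_neg hi, measure_univ]]
    exact Finset.prod_congr rfl fun i hi => by simp only [ht', if_pos hi]
  have hpre : (fun x : α × (ℕ → α) => seqCons x.1 x.2) ⁻¹'
      Set.pi (Finset.range (N + 1) : Set ℕ) t' =
      t' 0 ×ˢ Set.pi (Finset.range N : Set ℕ) fun i => t' (i + 1) := by
    ext ⟨a, f⟩
    simp only [Set.mem_preimage, Set.mem_pi, Finset.mem_coe, Finset.mem_range, Set.mem_prod]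
    constructor
    · exact fun h => ⟨h 0 (Nat.succ_pos _), fun i hi => h (i + 1) (Nat.succ_lt_succ hi)⟩
    · rintro ⟨h0, h⟩ i hi
      cases i with
      | zero => exact h0
      | succ i => exact h i (Nat.lt_of_succ_lt_succ hi)
  rw [hpi, hprod, Measure.map_apply measurable_seqCons
    (MeasurableSet.pi (Finset.countable_toSet _) fun i _ => hmeas i), hpre, Measure.prod_prod,
    Measure.infinitePi_pi _ fun i _ => hmeas _, Finset.prod_range_succ', mul_comm]

theorem lintegral_infinitePi_eq_tsum [Countable α] [MeasurableSingletonClass α] (μ : Measure α)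
    [IsProbabilityMeasure μ] {φ : (ℕ → α) → ENNReal} (hφ : Measurable φ) :
    ∫⁻ f, φ f ∂(Measure.infinitePi fun _ : ℕ => μ) =
      ∑' a, μ {a} * ∫⁻ f, φ (seqCons a f) ∂(Measure.infinitePi fun _ : ℕ => μ) := by
  conv_lhs => rw [← map_seqCons_infinitePi μ]
  rw [lintegral_map hφ measurable_seqCons,
    lintegral_prod (fun x : α × (ℕ → α) => φ (seqCons x.1 x.2))
      (hφ.comp measurable_seqCons).aemeasurable, lintegral_countable']
  exact tsum_congr fun a => mul_comm _ _

end Cons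

theorem tsum_pnat_eq_tsum_succPNat (f : ℕ+ → ENNReal) : ∑' k, f k = ∑' n : ℕ, f n.succPNat :=
  (Equiv.pnatEquivNat.symm.tsum_eq f).symm

instance : MeasurableSingletonClass ℕ+ := ⟨fun _ => trivial⟩

theorem measurable_incHead : Measurable incHead := by
  refine measurable_pi_lambda _ fun n => ?_
  cases n with
  | zero => exact (measurable_from_top (f := fun k : ℕ+ => k + 1)).comp (measurable_pi_apply 0)
  | succ n => exact measurable_pi_apply (n + 1)

/-- Memorylessness: with probability `1/2` the first term is `1` and a fresh sequence follows;
otherwise the first term minus one is again geometric, which is `incHead` of a fresh sequence. -/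
theorem lintegral_infinitePi_geometric (μ : Measure ℕ+) [IsProbabilityMeasure μ]
    (hμ : ∀ k : ℕ+, μ {k} = (2⁻¹ : ENNReal) ^ (k : ℕ)) {φ : (ℕ → ℕ+) → ENNReal} (hφ : Measurable φ) :
    ∫⁻ f, φ f ∂(Measure.infinitePi fun _ : ℕ => μ) =
      2⁻¹ * (∫⁻ f, φ (seqCons 1 f) ∂(Measure.infinitePi fun _ : ℕ => μ) +
        ∫⁻ f, φ (incHead f) ∂(Measure.infinitePi fun _ : ℕ => μ)) := by
  rw [lintegral_infinitePi_eq_tsum μ hφ,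
    lintegral_infinitePi_eq_tsum μ (φ := fun f => φ (incHead f)) (hφ.comp measurable_incHead),
    tsum_pnat_eq_tsum_succPNat,
    tsum_pnat_eq_tsum_succPNat, tsum_eq_zero_add' ENNReal.summable, mul_add]
  congr 1
  · rw [hμ]
    simp only [Nat.succPNat_coe, zero_add, Nat.succ_eq_add_one, pow_one]
    rfl
  · rw [← ENNReal.tsum_mul_left]
    refine tsum_congr fun n => ?_
    rw [hμ, hμ, Nat.succPNat_coe, Nat.succPNat_coe, Nat.succ_eq_add_one, pow_succ' _ (n + 1),
      mul_assoc]
    rfl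

theorem lintegral_prod_infinitePi {α : Type*} [MeasurableSpace α] [Countable α]
    [MeasurableSingletonClass α] (μ : Measure α) [IsProbabilityMeasure μ]
    (γ : Measure ℕ+) [IsProbabilityMeasure γ] (hγ : ∀ k : ℕ+, γ {k} = (2⁻¹ : ENNReal) ^ (k : ℕ))
    {φ : (ℕ → α) × (ℕ → ℕ+) → ENNReal} (hφ : Measurable φ) :
    ∫⁻ z, φ z ∂((Measure.infinitePi fun _ : ℕ => μ).prod (Measure.infinitePi fun _ : ℕ => γ)) =
      ∑' a, μ {a} * (2⁻¹ *
        (∫⁻ z, φ (seqCons a z.1, seqCons 1 z.2)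
          ∂((Measure.infinitePi fun _ : ℕ => μ).prod (Measure.infinitePi fun _ : ℕ => γ)) +
        ∫⁻ z, φ (seqCons a z.1, incHead z.2)
          ∂((Measure.infinitePi fun _ : ℕ => μ).prod (Measure.infinitePi fun _ : ℕ => γ)))) := by
  rw [lintegral_prod _ hφ.aemeasurable, lintegral_infinitePi_eq_tsum μ hφ.lintegral_prod_right']
  refine tsum_congr fun a => ?_
  have hcons : Measurable (seqCons a : (ℕ → α) → ℕ → α) :=
    measurable_seqCons.comp measurable_prodMk_left
  have hcons1 : Measurable (seqCons 1 : (ℕ → ℕ+) → ℕ → ℕ+) :=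
    measurable_seqCons.comp measurable_prodMk_left
  have h1 : Measurable fun z : (ℕ → α) × (ℕ → ℕ+) => φ (seqCons a z.1, seqCons 1 z.2) :=
    hφ.comp ((hcons.comp measurable_fst).prodMk (hcons1.comp measurable_snd))
  have h2 : Measurable fun z : (ℕ → α) × (ℕ → ℕ+) => φ (seqCons a z.1, incHead z.2) :=
    hφ.comp ((hcons.comp measurable_fst).prodMk (measurable_incHead.comp measurable_snd))
  rw [lintegral_prod _ h1.aemeasurable, lintegral_prod _ h2.aemeasurable,
    ← lintegral_add_left h1.lintegral_prod_right', ← lintegral_const_mul (2⁻¹ : ENNReal)]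
  · congr 1
    refine lintegral_congr fun f => ?_
    exact lintegral_infinitePi_geometric γ hγ (φ := fun y => φ (seqCons a f, y))
      (hφ.comp measurable_prodMk_left)
  · exact h1.lintegral_prod_right'.add h2.lintegral_prod_right'

/-! ### Measurability of the limit -/

theorem measurableSet_forall {α : Type*} {ι : Sort*} [MeasurableSpace α] [Countable ι] {p : ι → α → Prop}
    (h : ∀ i, MeasurableSet {a | p i a}) : MeasurableSet {a | ∀ i, p i a} := by
  convert! MeasurableSet.iInter h
  ext a
  simp

theorem measurableSet_exists {α : Type*} {ι : Sort*} [MeasurableSpace α] [Countable ι] {p : ι → α → Prop}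
    (h : ∀ i, MeasurableSet {a | p i a}) : MeasurableSet {a | ∃ i, p i a} := by
  convert! MeasurableSet.iUnion h
  ext a
  simp

namespace SeqSpace

instance : Countable NStar := inferInstanceAs (Countable (Option ℕ+))

/-- The topology is induced from a countable product of a countable space, so singletons in each
coordinate suffice. -/
theorem measurable_of_apply {α : Type*} [MeasurableSpace α] {g : α → SeqSpace}
    (h : ∀ (p : ℕ+) (v : NStar), MeasurableSet {a | g a p = v}) : Measurable g := by
  borelize NStar
  refine measurable_of_isOpen fun U hU => ?_
  obtain ⟨V, hV, rfl⟩ := isOpen_induced_iff.mp hU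
  have hg : Measurable fun a => (g a : ℕ+ → NStar) :=
    measurable_pi_iff.mpr fun p => measurable_to_countable' fun v => h p v
  exact hg hV.measurableSet

end SeqSpace

namespace Limit213

theorem enum_mem {I : Set ℕ+} (hI : I.Infinite) (k : ℕ) : enum I k ∈ I := by
  have : enum I k ∈ Set.range (enum I) := ⟨k, rfl⟩
  rwa [range_enum hI] at this

theorem exists_enum_eq {I : Set ℕ+} (hI : I.Infinite) {v : ℕ+} (hv : v ∈ I) :
    ∃ k, enum I k = v := by
  rwa [← range_enum hI] at hv

theorem enum_zero_eq_iff {I : Set ℕ+} (hI : I.Infinite) {u : ℕ+} :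
    enum I 0 = u ↔ u ∈ I ∧ ∀ v, v < u → v ∉ I := by
  constructor
  · rintro rfl
    refine ⟨enum_mem hI 0, fun v hv hvI => ?_⟩
    obtain ⟨m, rfl⟩ := exists_enum_eq hI hvI
    exact Nat.not_lt_zero _ ((enum_strictMono hI).lt_iff_lt.mp hv)
  · rintro ⟨hu, h⟩
    by_contra hne
    obtain ⟨m, rfl⟩ := exists_enum_eq hI hu
    refine h _ ((enum_strictMono hI).lt_iff_lt.mpr (Nat.pos_of_ne_zero ?_)) (enum_mem hI 0)
    rintro rfl
    exact hne rfl

/-- This reduces the enumeration to countably many membership conditions, as measurability in a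
random set requires. -/
theorem enum_succ_eq_iff {I : Set ℕ+} (hI : I.Infinite) {k : ℕ} {u : ℕ+} :
    enum I (k + 1) = u ↔ ∃ w, enum I k = w ∧ w < u ∧ u ∈ I ∧ ∀ v, w < v → v < u → v ∉ I := by
  constructor
  · rintro rfl
    refine ⟨_, rfl, enum_strictMono hI (Nat.lt_succ_self k), enum_mem hI _, fun v h1 h2 hv => ?_⟩
    obtain ⟨m, rfl⟩ := exists_enum_eq hI hv
    rw [(enum_strictMono hI).lt_iff_lt] at h1 h2
    omega
  · rintro ⟨w, rfl, hlt, hu, h⟩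
    obtain ⟨m, rfl⟩ := exists_enum_eq hI hu
    rw [(enum_strictMono hI).lt_iff_lt] at hlt
    rcases (Nat.succ_le_of_lt hlt).eq_or_lt with he | hlt'
    · rw [← he]
    · exact absurd (enum_mem hI _) (h _ (enum_strictMono hI (Nat.lt_succ_self k))
        (enum_strictMono hI hlt'))

section Measurability

variable {α : Type*} [MeasurableSpace α]

theorem measurableSet_enum_eq {I : α → Set ℕ+} (hI : ∀ a, (I a).Infinite)
    (hmem : ∀ v, MeasurableSet {a | v ∈ I a}) (k : ℕ) (u : ℕ+) :
    MeasurableSet {a | enum (I a) k = u} := by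
  induction k generalizing u with
  | zero =>
    simp only [enum_zero_eq_iff (hI _)]
    exact (hmem u).inter (measurableSet_forall fun v =>
      measurableSet_forall (p := fun _ _ => _) fun _ => (hmem v).compl)
  | succ k ih =>
    simp only [enum_succ_eq_iff (hI _)]
    refine measurableSet_exists fun w => (ih w).inter ((MeasurableSet.const _).inter
      ((hmem u).inter ?_))
    exact measurableSet_forall fun v => measurableSet_forall (p := fun _ _ => _) fun _ =>
      measurableSet_forall (p := fun _ _ => _) fun _ => (hmem v).compl

theorem measurable_concat {J : α → ℕ → ℕ} {I : α → Set ℕ+} (hI : ∀ a, (I a).Infinite)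
    (hJ : Measurable J) (hmem : ∀ v, MeasurableSet {a | v ∈ I a}) :
    Measurable fun a => concat (J a) (I a) (hI a) := by
  have hpos : ∀ k (p : ℕ+), MeasurableSet {a | (p : ℕ) = position (J a) k} := by
    intro k p
    have : Measurable fun a => position (J a) k :=
      Finset.measurable_sum (Finset.range (k + 1)) fun j _ =>
        ((measurable_pi_apply j).comp hJ).add_const 1
    exact measurableSet_eq_fun measurable_const this
  refine SeqSpace.measurable_of_apply fun p v => ?_
  induction v using OnePoint.rec with
  | infty =>
    have : {a | concat (J a) (I a) (hI a) p = ∞} = {a | ∀ k, (p : ℕ) ≠ position (J a) k} := by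
      ext a
      refine ⟨fun h k hk => ?_, concat_of_ne _⟩
      exact OnePoint.coe_ne_infty _ ((concat_of_eq (hI a) hk).symm.trans h)
    rw [this]
    exact measurableSet_forall fun k => (hpos k p).compl
  | coe u =>
    have : {a | concat (J a) (I a) (hI a) p = (u : NStar)} =
        {a | ∃ k, (p : ℕ) = position (J a) k ∧ enum (I a) k = u} := by
      ext a
      constructor
      · intro h
        by_cases hp : ∃ k, (p : ℕ) = position (J a) k
        · obtain ⟨k, hp⟩ := hp
          exact ⟨k, hp, OnePoint.coe_injective ((concat_of_eq (hI a) hp).symm.trans h)⟩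
        · push Not at hp
          exact absurd (Eq.trans (Eq.symm h) (concat_of_ne (hI a) hp)) (OnePoint.coe_ne_infty u)
      · rintro ⟨k, hk, rfl⟩
        exact concat_of_eq _ hk
    rw [this]
    exact measurableSet_exists fun k => (hpos k p).inter (measurableSet_enum_eq hI hmem k u)

theorem measurable_partialSum {f : α → ℕ → ℕ+} (hf : Measurable f) (n : ℕ) :
    Measurable fun a => partialSum (fun j => f a j) n :=
  Finset.measurable_sum _ fun j _ =>
    (measurable_from_top (f := PNat.val)).comp ((measurable_pi_apply j).comp hf)

theorem measurable_partialSum_comp {f : α → ℕ → ℕ+} (hf : Measurable f) {N : α → ℕ}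
    (hN : Measurable N) : Measurable fun a => partialSum (fun j => f a j) (N a) := by
  refine measurable_to_countable' fun m => ?_
  have : (fun a => partialSum (fun j => f a j) (N a)) ⁻¹' {m} =
      {a | ∃ n, N a = n ∧ partialSum (fun j => f a j) n = m} := by
    ext a
    simp
  rw [this]
  exact measurableSet_exists fun n => (measurableSet_eq_fun hN measurable_const).inter
    (measurableSet_eq_fun (measurable_partialSum hf n) measurable_const)

variable {x : α → ℕ → ℕ} {xh y1 y2 : α → ℕ → ℕ+}

theorem measurable_limit1 (hx : Measurable x) (hxh : Measurable xh) (hy1 : Measurable y1)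
    (hy2 : Measurable y2) : Measurable fun a => limit1 (x a) (xh a) (y1 a) (y2 a) := by
  refine measurable_concat _ hx fun v => measurableSet_exists fun n => ?_
  have h := measurable_partialSum_comp hxh (measurable_partialSum hy2 n)
  exact (measurableSet_le (((measurable_partialSum hy1 n).add h).add_const 1)
    measurable_const).inter
      (measurableSet_le measurable_const ((measurable_partialSum hy1 (n + 1)).add h))

theorem measurable_limit0 (hx : Measurable x) (hxh : Measurable xh) (hy1 : Measurable y1)
    (hy2 : Measurable y2) : Measurable fun a => limit0 (x a) (xh a) (y1 a) (y2 a) := by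
  refine measurable_concat _ hx fun v => measurableSet_exists fun n => ?_
  have h := measurable_partialSum_comp hxh (measurable_partialSum hy2 (n + 1))
  exact (measurableSet_le (((measurable_partialSum hy1 n).add h).add_const 1)
    measurable_const).inter
      (measurableSet_le measurable_const ((measurable_partialSum hy1 (n + 1)).add h))

theorem measurable_limitFun {c : α → Fin 2} (hx : Measurable x) (hxh : Measurable xh)
    (hy1 : Measurable y1) (hy2 : Measurable y2) (hc : Measurable c) :
    Measurable fun a => limitFun (x a) (xh a) (y1 a) (y2 a) (c a) :=
  Measurable.ite (hc (measurableSet_singleton 1)) (measurable_limit1 hx hxh hy1 hy2)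
    (measurable_limit0 hx hxh hy1 hy2)

end Measurability

end Limit213

/-! ### The fixed-point equation of the limit law -/

theorem SeqSpace.measurable_prepend (j : ℕ) : Measurable (SeqSpace.prepend j) :=
  (SeqSpace.lipschitzWith_prepend j).continuous.measurable

theorem SeqSpace.measurable_shift (x : ℕ+) : Measurable (SeqSpace.shift x) :=
  (SeqSpace.lipschitzWith_shift x).continuous.measurable

namespace Limit213

/-- The tuples `((X, Y1), (Xhat, Y2))`. -/
abbrev Tuple : Type := ((ℕ → ℕ) × (ℕ → ℕ+)) × ((ℕ → ℕ+) × (ℕ → ℕ+))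

/-- The joint law of `((X, Y1), (Xhat, Y2))`. -/
noncomputable def tupleLaw (μ : Measure ℕ) (μh γ : Measure ℕ+) : Measure Tuple :=
  ((Measure.infinitePi fun _ : ℕ => μ).prod (Measure.infinitePi fun _ : ℕ => γ)).prod
    ((Measure.infinitePi fun _ : ℕ => μh).prod (Measure.infinitePi fun _ : ℕ => γ))

/-- `∞^{(J)} * I^{(1)}` as a function of the tuple. -/
noncomputable def tupleLimit1 (z : Tuple) : SeqSpace := limit1 z.1.1 z.2.1 z.1.2 z.2.2

/-- `∞^{(J)} * I^{(0)}` as a function of the tuple. -/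
noncomputable def tupleLimit0 (z : Tuple) : SeqSpace := limit0 z.1.1 z.2.1 z.1.2 z.2.2

theorem measurable_tupleLimit1 : Measurable tupleLimit1 :=
  measurable_limit1 (measurable_fst.comp measurable_fst) (measurable_fst.comp measurable_snd)
    (measurable_snd.comp measurable_fst) (measurable_snd.comp measurable_snd)

theorem measurable_tupleLimit0 : Measurable tupleLimit0 :=
  measurable_limit0 (measurable_fst.comp measurable_fst) (measurable_fst.comp measurable_snd)
    (measurable_snd.comp measurable_fst) (measurable_snd.comp measurable_snd)

/-- The law of the limit: `∞^{(J)} * I^{(1)}` and `∞^{(J)} * I^{(0)}` with probability `1 / 2`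
each. -/
noncomputable def limitLaw (μ : Measure ℕ) (μh γ : Measure ℕ+) : Measure SeqSpace :=
  (2⁻¹ : ENNReal) •
    ((tupleLaw μ μh γ).map tupleLimit0 + (tupleLaw μ μh γ).map tupleLimit1)

theorem lintegral_limitLaw (μ : Measure ℕ) (μh γ : Measure ℕ+) {φ : SeqSpace → ENNReal}
    (hφ : Measurable φ) :
    ∫⁻ σ, φ σ ∂(limitLaw μ μh γ) = 2⁻¹ * (∫⁻ z, φ (tupleLimit0 z) ∂(tupleLaw μ μh γ) +
      ∫⁻ z, φ (tupleLimit1 z) ∂(tupleLaw μ μh γ)) := by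
  rw [limitLaw, lintegral_smul_measure, lintegral_add_measure,
    lintegral_map hφ measurable_tupleLimit0, lintegral_map hφ measurable_tupleLimit1, smul_eq_mul]

variable (μ : Measure ℕ) [IsProbabilityMeasure μ] (μh γ : Measure ℕ+) [IsProbabilityMeasure μh]
  [IsProbabilityMeasure γ]

instance : IsProbabilityMeasure (tupleLaw μ μh γ) := by
  unfold tupleLaw
  infer_instance

/-- A step from state 1 uses one term of `X` and one coin hidden in `Y1`, and leaves `Xhat` and `Y2`
untouched; this is why the tuple is grouped as it is. The coin chooses between the states equally,
which reproduces `limitLaw`. -/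
theorem lintegral_tupleLimit1 (hγ : ∀ k : ℕ+, γ {k} = (2⁻¹ : ENNReal) ^ (k : ℕ))
    {φ : SeqSpace → ENNReal} (hφ : Measurable φ) :
    ∫⁻ z, φ (tupleLimit1 z) ∂(tupleLaw μ μh γ) =
      ∑' j, μ {j} * ∫⁻ σ, φ (SeqSpace.prepend j σ) ∂(limitLaw μ μh γ) := by
  have h1 : Measurable fun z => φ (tupleLimit1 z) := hφ.comp measurable_tupleLimit1
  rw [tupleLaw, lintegral_prod (fun z => φ (tupleLimit1 z)) h1.aemeasurable,
    lintegral_prod_infinitePi μ γ hγ h1.lintegral_prod_right']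
  refine tsum_congr fun j => ?_
  have hφ' := hφ.comp (SeqSpace.measurable_prepend j)
  rw [lintegral_limitLaw μ μh γ (φ := fun σ => φ (SeqSpace.prepend j σ)) hφ', tupleLaw,
    lintegral_prod (fun z => φ (SeqSpace.prepend j (tupleLimit0 z)))
      (hφ'.comp measurable_tupleLimit0).aemeasurable,
    lintegral_prod (fun z => φ (SeqSpace.prepend j (tupleLimit1 z)))
      (hφ'.comp measurable_tupleLimit1).aemeasurable]
  simp only [tupleLimit1, tupleLimit0, limit1_incHead, limit1_seqCons_one]

theorem lintegral_tupleLimit0 (hγ : ∀ k : ℕ+, γ {k} = (2⁻¹ : ENNReal) ^ (k : ℕ))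
    {φ : SeqSpace → ENNReal} (hφ : Measurable φ) :
    ∫⁻ z, φ (tupleLimit0 z) ∂(tupleLaw μ μh γ) =
      ∑' x, μh {x} * ∫⁻ σ, φ (SeqSpace.shift x σ) ∂(limitLaw μ μh γ) := by
  have h1 : Measurable fun z => φ (tupleLimit0 z) := hφ.comp measurable_tupleLimit0
  rw [tupleLaw, lintegral_prod_symm (fun z => φ (tupleLimit0 z)) h1.aemeasurable,
    lintegral_prod_infinitePi μh γ hγ h1.lintegral_prod_left']
  refine tsum_congr fun x => ?_
  have hφ' := hφ.comp (SeqSpace.measurable_shift x)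
  rw [lintegral_limitLaw μ μh γ (φ := fun σ => φ (SeqSpace.shift x σ)) hφ', tupleLaw,
    lintegral_prod_symm (fun z => φ (SeqSpace.shift x (tupleLimit0 z)))
      (hφ'.comp measurable_tupleLimit0).aemeasurable,
    lintegral_prod_symm (fun z => φ (SeqSpace.shift x (tupleLimit1 z)))
      (hφ'.comp measurable_tupleLimit1).aemeasurable]
  simp only [tupleLimit1, tupleLimit0, limit0_incHead, limit0_seqCons_one]
  rw [add_comm]

/-- The fair initial state gives the factor `1/2`. As `Xhat - 1` has the law of `X`, the terms for
`prepend j` and for the shift by `j + 1` share one coefficient. -/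
theorem limitLaw_eq_sum (hμh : ∀ k : ℕ, μh {k.succPNat} = μ {k})
    (hγ : ∀ k : ℕ+, γ {k} = (2⁻¹ : ENNReal) ^ (k : ℕ)) :
    limitLaw μ μh γ = Measure.sum fun j : ℕ => (2⁻¹ * μ {j}) •
      ((limitLaw μ μh γ).map (SeqSpace.prepend j) +
        (limitLaw μ μh γ).map (SeqSpace.shift j.succPNat)) := by
  refine Measure.ext_of_lintegral _ fun φ hφ => ?_
  rw [lintegral_limitLaw μ μh γ hφ, lintegral_tupleLimit0 μ μh γ hγ hφ,
    lintegral_tupleLimit1 μ μh γ hγ hφ, tsum_pnat_eq_tsum_succPNat, add_comm,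
    ← ENNReal.tsum_add, ← ENNReal.tsum_mul_left, lintegral_sum_measure]
  refine tsum_congr fun j => ?_
  rw [lintegral_smul_measure, lintegral_add_measure, lintegral_map hφ (SeqSpace.measurable_prepend j),
    lintegral_map hφ (SeqSpace.measurable_shift _), hμh, smul_eq_mul, mul_assoc,
    mul_add, mul_add, mul_add]

end Limit213

/-! ### From mutual independence to product laws -/

section Independence

variable {Ω : Type*} {mΩ : MeasurableSpace Ω} {P : Measure Ω} {ι κ : Type*}
  {m₁ : ι → MeasurableSpace Ω} {m₂ : κ → MeasurableSpace Ω}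

theorem ProbabilityTheory.iIndep.sumElim_left (h : iIndep (Sum.elim m₁ m₂) P) : iIndep m₁ P :=
  h.precomp (g := Sum.inl) Sum.inl_injective

theorem ProbabilityTheory.iIndep.sumElim_right (h : iIndep (Sum.elim m₁ m₂) P) : iIndep m₂ P :=
  h.precomp (g := Sum.inr) Sum.inr_injective

theorem ProbabilityTheory.iIndep.map_prodMk {α β : Type*} [MeasurableSpace α] [MeasurableSpace β]
    [IsProbabilityMeasure P]
    (h : iIndep (Sum.elim m₁ m₂) P) (h₁ : ∀ i, m₁ i ≤ mΩ) (h₂ : ∀ i, m₂ i ≤ mΩ)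
    {f : Ω → α} {g : Ω → β} (hf : Measurable[⨆ i, m₁ i] f) (hg : Measurable[⨆ i, m₂ i] g) :
    P.map (fun ω => (f ω, g ω)) = (P.map f).prod (P.map g) := by
  have hle : ∀ i, Sum.elim m₁ m₂ i ≤ mΩ := by
    rintro (i | i)
    · exact h₁ i
    · exact h₂ i
  have hind := indep_iSup_of_disjoint hle h
    (Set.isCompl_range_inl_range_inr (α := ι) (β := κ)).disjoint
  rw [iSup_range, iSup_range] at hind
  have hfg : IndepFun f g P := by
    rw [IndepFun_iff_Indep]
    exact indep_of_indep_of_le_right (indep_of_indep_of_le_left hind hf.comap_le) hg.comap_le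
  exact (indepFun_iff_map_prod_eq_prod_map_map (hf.mono (iSup_le h₁) le_rfl).aemeasurable
    (hg.mono (iSup_le h₂) le_rfl).aemeasurable).mp hfg

theorem measurable_sequence_iSup_comap {E : Type*} [MeasurableSpace E] (f : ℕ → Ω → E) :
    Measurable[⨆ n, Limit213.sigmaAlg (f n)] fun ω n => f n ω :=
  @measurable_pi_lambda _ _ _ (⨆ n, Limit213.sigmaAlg (f n)) _ _ fun n =>
    (comap_measurable (f n)).mono (le_iSup (fun n => Limit213.sigmaAlg (f n)) n) le_rfl

theorem Measurable.prodMk_iSup_sumElim {α β : Type*} [MeasurableSpace α] [MeasurableSpace β]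
    {f : Ω → α} {g : Ω → β} (hf : Measurable[⨆ i, m₁ i] f) (hg : Measurable[⨆ i, m₂ i] g) :
    Measurable[⨆ i, Sum.elim m₁ m₂ i] fun ω => (f ω, g ω) := by
  refine @Measurable.prodMk _ (⨆ i, Sum.elim m₁ m₂ i) _ _ _ _ _ _ (hf.mono ?_ le_rfl)
    (hg.mono ?_ le_rfl)
  · exact iSup_le fun i => le_iSup (Sum.elim m₁ m₂) (Sum.inl i)
  · exact iSup_le fun i => le_iSup (Sum.elim m₁ m₂) (Sum.inr i)

theorem map_sequence_eq_infinitePi {E : Type*} [MeasurableSpace E] [IsProbabilityMeasure P]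
    {f : ℕ → Ω → E} (hf : ∀ n, Measurable (f n))
    (h : iIndep (fun n => Limit213.sigmaAlg (f n)) P) (hlaw : ∀ n, P.map (f n) = P.map (f 0)) :
    P.map (fun ω n => f n ω) = Measure.infinitePi fun _ : ℕ => P.map (f 0) := by
  have := ((iIndepFun_iff_iIndep _ _ _).mpr h).map_fun_eq_infinitePi_map hf
  rw [this]
  congr 1
  exact funext hlaw

theorem map_eq_map_of_real_eq [IsProbabilityMeasure P] {E : Type*} [MeasurableSpace E]
    [Countable E] [MeasurableSingletonClass E] {f g : Ω → E} (hf : Measurable f)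
    (hg : Measurable g) (h : ∀ k, P.real {ω | f ω = k} = P.real {ω | g ω = k}) :
    P.map f = P.map g := by
  refine Measure.ext_of_singleton fun k => ?_
  rw [Measure.map_apply hf (measurableSet_singleton k),
    Measure.map_apply hg (measurableSet_singleton k)]
  have := h k
  rwa [measureReal_eq_measureReal_iff] at this

end Independence

namespace Limit213

variable {Ω : Type*} [MeasurableSpace Ω] {P : Measure Ω} [IsProbabilityMeasure P]
  {X : ℕ → Ω → ℕ} {Xhat Y1 Y2 : ℕ → Ω → ℕ+} {χ : Ω → Fin 2}

theorem map_tuple_eq (hX : ∀ n, Measurable (X n)) (hXhat : ∀ n, Measurable (Xhat n))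
    (hY1 : ∀ n, Measurable (Y1 n)) (hY2 : ∀ n, Measurable (Y2 n)) (hχ : Measurable χ)
    (h_indep : iIndep
      (Sum.elim (fun n => Limit213.sigmaAlg (X n))
        (Sum.elim (fun n => Limit213.sigmaAlg (Xhat n))
          (Sum.elim (fun n => Limit213.sigmaAlg (Y1 n))
            (Sum.elim (fun n => Limit213.sigmaAlg (Y2 n))
              (fun _ : Unit => Limit213.sigmaAlg χ))))) P)
    (hXl : ∀ n, P.map (X n) = P.map (X 0)) (hXhatl : ∀ n, P.map (Xhat n) = P.map (Xhat 0))
    (hY1l : ∀ n, P.map (Y1 n) = P.map (Y1 0)) (hY2l : ∀ n, P.map (Y2 n) = P.map (Y1 0)) :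
    P.map (fun ω => ((((X · ω), (Y1 · ω)), ((Xhat · ω), (Y2 · ω))), χ ω)) =
      (tupleLaw (P.map (X 0)) (P.map (Xhat 0)) (P.map (Y1 0))).prod (P.map χ) := by
  -- Regroups the index type so that its nesting matches the product structure of `tupleLaw`; each
  -- `⊕` then becomes one product of measures.
  let g : ((ℕ ⊕ ℕ) ⊕ (ℕ ⊕ ℕ)) ⊕ Unit → ℕ ⊕ (ℕ ⊕ (ℕ ⊕ (ℕ ⊕ Unit))) :=
    Sum.elim (Sum.elim (Sum.elim Sum.inl fun n => .inr (.inr (.inl n)))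
      (Sum.elim (fun n => .inr (.inl n)) fun n => .inr (.inr (.inr (.inl n)))))
      fun u => .inr (.inr (.inr (.inr u)))
  have hg : Function.Injective g := by
    rintro (((a | a) | (a | a)) | a) (((b | b) | (b | b)) | b) hab <;> simp_all [g]
  have h5 : iIndep (Sum.elim (Sum.elim
      (Sum.elim (fun n => Limit213.sigmaAlg (X n)) (fun n => Limit213.sigmaAlg (Y1 n)))
      (Sum.elim (fun n => Limit213.sigmaAlg (Xhat n)) (fun n => Limit213.sigmaAlg (Y2 n))))
      (fun _ : Unit => Limit213.sigmaAlg χ)) P := by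
    convert h_indep.precomp hg using 1
    funext i
    rcases i with ((a | a) | (a | a)) | a <;> rfl
  have h4 := h5.sumElim_left
  have hXY := h4.sumElim_left
  have hXhY := h4.sumElim_right
  have leX := fun n => (hX n).comap_le
  have leXhat := fun n => (hXhat n).comap_le
  have leY1 := fun n => (hY1 n).comap_le
  have leY2 := fun n => (hY2 n).comap_le
  have le1 : ∀ i, Sum.elim (fun n => Limit213.sigmaAlg (X n)) (fun n => Limit213.sigmaAlg (Y1 n)) i
      ≤ ‹MeasurableSpace Ω› := Sum.rec leX leY1
  have le2 : ∀ i, Sum.elim (fun n => Limit213.sigmaAlg (Xhat n))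
      (fun n => Limit213.sigmaAlg (Y2 n)) i ≤ ‹MeasurableSpace Ω› := Sum.rec leXhat leY2
  have m1 := (measurable_sequence_iSup_comap X).prodMk_iSup_sumElim
    (measurable_sequence_iSup_comap Y1)
  have m2 := (measurable_sequence_iSup_comap Xhat).prodMk_iSup_sumElim
    (measurable_sequence_iSup_comap Y2)
  rw [h5.map_prodMk (Sum.rec le1 le2) (fun _ => hχ.comap_le) (m1.prodMk_iSup_sumElim m2)
      ((comap_measurable χ).mono (le_iSup (fun _ : Unit => Limit213.sigmaAlg χ) ()) le_rfl),
    h4.map_prodMk le1 le2 m1 m2,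
    hXY.map_prodMk leX leY1 (measurable_sequence_iSup_comap X) (measurable_sequence_iSup_comap Y1),
    hXhY.map_prodMk leXhat leY2 (measurable_sequence_iSup_comap Xhat)
      (measurable_sequence_iSup_comap Y2),
    map_sequence_eq_infinitePi hX hXY.sumElim_left hXl,
    map_sequence_eq_infinitePi hY1 hXY.sumElim_right hY1l,
    map_sequence_eq_infinitePi hXhat hXhY.sumElim_left hXhatl,
    map_sequence_eq_infinitePi hY2 hXhY.sumElim_right fun n => (hY2l n).trans (hY2l 0).symm,
    hY2l 0, tupleLaw]

theorem map_limitFun_eq (hX : ∀ n, Measurable (X n)) (hXhat : ∀ n, Measurable (Xhat n))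
    (hY1 : ∀ n, Measurable (Y1 n)) (hY2 : ∀ n, Measurable (Y2 n)) (hχ : Measurable χ)
    {μ : Measure ℕ} {μh γ : Measure ℕ+} [IsProbabilityMeasure μ] [IsProbabilityMeasure μh]
    [IsProbabilityMeasure γ]
    (h : P.map (fun ω => ((((X · ω), (Y1 · ω)), ((Xhat · ω), (Y2 · ω))), χ ω)) =
      (tupleLaw μ μh γ).prod (P.map χ)) (hχl : ∀ c, P.map χ {c} = 2⁻¹) :
    P.map (fun ω => limitFun (X · ω) (Xhat · ω) (Y1 · ω) (Y2 · ω) (χ ω)) = limitLaw μ μh γ := by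
  have : IsProbabilityMeasure (P.map χ) := Measure.isProbabilityMeasure_map hχ.aemeasurable
  have hT : Measurable fun ω => ((((X · ω), (Y1 · ω)), ((Xhat · ω), (Y2 · ω))), χ ω) :=
    (((measurable_pi_lambda _ hX).prodMk (measurable_pi_lambda _ hY1)).prodMk
      ((measurable_pi_lambda _ hXhat).prodMk (measurable_pi_lambda _ hY2))).prodMk hχ
  have hL : Measurable fun z : Tuple × Fin 2 => limitFun z.1.1.1 z.1.2.1 z.1.1.2 z.1.2.2 z.2 :=
    measurable_limitFun (by fun_prop) (by fun_prop) (by fun_prop) (by fun_prop) measurable_snd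
  have hcomp : (fun ω => limitFun (X · ω) (Xhat · ω) (Y1 · ω) (Y2 · ω) (χ ω)) =
      (fun z : Tuple × Fin 2 => limitFun z.1.1.1 z.1.2.1 z.1.1.2 z.1.2.2 z.2) ∘
        fun ω => ((((X · ω), (Y1 · ω)), ((Xhat · ω), (Y2 · ω))), χ ω) := rfl
  rw [hcomp, ← Measure.map_map hL hT, h]
  refine Measure.ext_of_lintegral _ fun φ hφ => ?_
  rw [lintegral_limitLaw μ μh γ hφ, lintegral_map hφ hL,
    lintegral_prod_symm (fun z : Tuple × Fin 2 => φ (limitFun z.1.1.1 z.1.2.1 z.1.1.2 z.1.2.2 z.2))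
      (hφ.comp hL).aemeasurable, lintegral_fintype, Fin.sum_univ_two, hχl, hχl, ← add_mul,
    mul_comm]
  simp only [limitFun, tupleLimit0, tupleLimit1, limit0, limit1, if_true, zero_ne_one, if_false]

end Limit213

/-! ### Averages with weights concentrating at both ends -/

section Tannery

theorem sum_range_eq_sum_both_ends {M : Type*} [AddCommMonoid M] (x : ℕ → M) {n K : ℕ}
    (h : 2 * K ≤ n) :
    ∑ j ∈ Finset.range (n + 1), x j =
      ∑ j ∈ Finset.range K, (x j + x (n - j)) + ∑ j ∈ Finset.Ico K (n + 1 - K), x j := by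
  have h1 := Finset.sum_Ico_reflect x 0 (show K ≤ n + 1 by omega)
  rw [Finset.sum_add_distrib, Finset.range_eq_Ico, Finset.range_eq_Ico, h1, Nat.sub_zero,
    ← Finset.sum_Ico_consecutive x (show 0 ≤ K by omega) (show K ≤ n + 1 by omega),
    ← Finset.sum_Ico_consecutive x (show K ≤ n + 1 - K by omega) (show n + 1 - K ≤ n + 1 by omega),
    add_assoc, add_comm (∑ j ∈ Finset.Ico K (n + 1 - K), x j)]

/-- A form of Tannery's theorem for weighted averages whose weights concentrate at both ends. -/
theorem eventually_abs_weighted_sum_sub_le {v : ℕ → ℝ} (hv : HasSum v (1 / 2)) {w : ℕ → ℕ → ℝ}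
    (hw : ∀ n j, 0 ≤ w n j) (hw1 : ∀ n, ∑ j ∈ Finset.range (n + 1), w n j = 1)
    (hsymm : ∀ n j, j ≤ n → w n (n - j) = w n j)
    (hlim : ∀ j, Tendsto (fun n => w n j) atTop (𝓝 (v j))) {a : ℕ → ℕ → ℝ} {A B : ℕ → ℝ}
    {L c b δ : ℝ} (hL : HasSum (fun j => v j * (A j + B j)) L) (hb : ∀ n j, |a n j - c| ≤ b)
    (hA : ∀ j, ∀ ε > 0, ∀ᶠ n in atTop, |a n j - A j| ≤ δ + ε)
    (hB : ∀ j, ∀ ε > 0, ∀ᶠ n in atTop, |a n (n - j) - B j| ≤ δ + ε) (hδ : 0 ≤ δ) :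
    ∀ ε > 0, ∀ᶠ n in atTop, |∑ j ∈ Finset.range (n + 1), w n j * a n j - L| ≤ δ + ε := by
  intro ε' hε'
  -- Two parts for the middle range, one each for the ends, for the limit of the weights and for the
  -- truncated series.
  obtain ⟨ε, hε, rfl⟩ : ∃ ε > 0, ε' = 5 * ε := ⟨ε' / 5, by positivity, by ring⟩
  have hb0 : 0 ≤ b := (abs_nonneg _).trans (hb 0 0)
  -- Everything is centred at `c`, so that the middle range is controlled by its mass times `b`.
  have hL' : HasSum (fun j => v j * (A j + B j - 2 * c)) (L - c) := by
    have := hL.sub (hv.mul_right (2 * c))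
    convert! this using 1
    · ext j; ring
    · ring
  have hG := hL'.tendsto_sum_nat
  have hV := hv.tendsto_sum_nat
  have e1 : ∀ᶠ K in atTop, |∑ j ∈ Finset.range K, v j * (A j + B j - 2 * c) - (L - c)| < ε :=
    (tendsto_iff_norm_sub_tendsto_zero.mp hG).eventually_lt_const hε
  have e2 : ∀ᶠ K in atTop, b * (1 - 2 * ∑ j ∈ Finset.range K, v j) < ε := by
    have : Tendsto (fun K => b * (1 - 2 * ∑ j ∈ Finset.range K, v j)) atTop (𝓝 0) := by
      simpa using ((hV.const_mul 2).const_sub 1).const_mul b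
    exact this.eventually_lt_const hε
  obtain ⟨K, hK1, hK2⟩ := (e1.and e2).exists
  have e3 : ∀ᶠ n in atTop, |∑ j ∈ Finset.range K, w n j * (A j + B j - 2 * c) -
      ∑ j ∈ Finset.range K, v j * (A j + B j - 2 * c)| < ε :=
    (tendsto_iff_norm_sub_tendsto_zero.mp (tendsto_finsetSum _ fun j _ =>
      (hlim j).mul_const _)).eventually_lt_const hε
  -- By symmetry of the weights, `1 - 2 ∑` is exactly the mass of the middle range.
  have e4 : ∀ᶠ n in atTop, b * (1 - 2 * ∑ j ∈ Finset.range K, w n j) < 2 * ε := by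
    have : Tendsto (fun n => b * (1 - 2 * ∑ j ∈ Finset.range K, w n j)) atTop
        (𝓝 (b * (1 - 2 * ∑ j ∈ Finset.range K, v j))) :=
      (((tendsto_finsetSum _ fun j _ => hlim j).const_mul 2).const_sub 1).const_mul b
    exact this.eventually_lt_const (by linarith)
  have e5 : ∀ᶠ n in atTop, ∀ j ∈ Finset.range K,
      |a n j - A j| ≤ δ + ε ∧ |a n (n - j) - B j| ≤ δ + ε :=
    (Finset.range K).eventually_all.mpr fun j _ => (hA j ε hε).and (hB j ε hε)
  filter_upwards [e3, e4, e5, eventually_ge_atTop (2 * K)] with n h3 h4 h5 hn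
  have hsplit1 := sum_range_eq_sum_both_ends (w n) hn
  have hends : ∑ j ∈ Finset.range K, (w n j + w n (n - j)) = 2 * ∑ j ∈ Finset.range K, w n j := by
    rw [Finset.mul_sum]
    refine Finset.sum_congr rfl fun j hj => ?_
    rw [hsymm n j (by rw [Finset.mem_range] at hj; omega)]
    ring
  rw [hw1, hends] at hsplit1
  have hsplit2 := sum_range_eq_sum_both_ends (fun j => w n j * (a n j - c)) hn
  have hends2 : ∑ j ∈ Finset.range K, (w n j * (a n j - c) + w n (n - j) * (a n (n - j) - c)) =
      ∑ j ∈ Finset.range K, w n j * ((a n j - A j) + (a n (n - j) - B j)) +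
      ∑ j ∈ Finset.range K, w n j * (A j + B j - 2 * c) := by
    rw [← Finset.sum_add_distrib]
    refine Finset.sum_congr rfl fun j hj => ?_
    rw [hsymm n j (by rw [Finset.mem_range] at hj; omega)]
    ring
  rw [hends2] at hsplit2
  have hc : ∑ j ∈ Finset.range (n + 1), w n j * (a n j - c) =
      ∑ j ∈ Finset.range (n + 1), w n j * a n j - c := by
    simp only [mul_sub, Finset.sum_sub_distrib, ← Finset.sum_mul, hw1, one_mul]
  have hmid0 : 0 ≤ ∑ j ∈ Finset.Ico K (n + 1 - K), w n j := Finset.sum_nonneg fun j _ => hw n j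
  have hmid : |∑ j ∈ Finset.Ico K (n + 1 - K), w n j * (a n j - c)| ≤ 2 * ε := by
    refine (Finset.abs_sum_le_sum_abs _ _).trans ?_
    have : ∑ j ∈ Finset.Ico K (n + 1 - K), |w n j * (a n j - c)| ≤
        ∑ j ∈ Finset.Ico K (n + 1 - K), w n j * b := by
      refine Finset.sum_le_sum fun j _ => ?_
      rw [abs_mul, abs_of_nonneg (hw n j)]
      exact mul_le_mul_of_nonneg_left (hb n j) (hw n j)
    rw [← Finset.sum_mul] at this
    have h6 : (∑ j ∈ Finset.Ico K (n + 1 - K), w n j) * b =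
      b * (1 - 2 * ∑ j ∈ Finset.range K, w n j) := by rw [hsplit1]; ring
    linarith
  have hend : |∑ j ∈ Finset.range K, w n j * ((a n j - A j) + (a n (n - j) - B j))| ≤ δ + ε := by
    refine (Finset.abs_sum_le_sum_abs _ _).trans ?_
    have : ∑ j ∈ Finset.range K, |w n j * ((a n j - A j) + (a n (n - j) - B j))| ≤
        ∑ j ∈ Finset.range K, w n j * (2 * (δ + ε)) := by
      refine Finset.sum_le_sum fun j hj => ?_
      rw [abs_mul, abs_of_nonneg (hw n j)]
      refine mul_le_mul_of_nonneg_left ((abs_add_le _ _).trans ?_) (hw n j)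
      linarith [(h5 j hj).1, (h5 j hj).2]
    rw [← Finset.sum_mul] at this
    -- The two ends together weigh at most `1`, so `δ` is not amplified; the iteration of the
    -- recursion depends on this.
    have h7 : 2 * ∑ j ∈ Finset.range K, w n j ≤ 1 := by linarith
    have h8 := mul_le_mul_of_nonneg_right h7 (show 0 ≤ δ + ε by positivity)
    linarith
  rw [hc] at hsplit2
  rw [abs_le] at hmid hend ⊢
  rw [abs_lt] at h3 hK1
  constructor <;> linarith

end Tannery

/-! ### Asymptotics of the splitting probabilities -/

section Catalan

theorem catalan_pos (n : ℕ) : 0 < catalan n := by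
  have h := succ_mul_catalan_eq_centralBinom n
  have := n.centralBinom_pos
  exact Nat.pos_of_ne_zero fun h0 => by simp [h0] at h; omega

theorem catalan_succ_mul (n : ℕ) : (n + 2) * catalan (n + 1) = (4 * n + 2) * catalan n := by
  have h1 := succ_mul_catalan_eq_centralBinom n
  have h2 := succ_mul_catalan_eq_centralBinom (n + 1)
  have h3 := n.succ_mul_centralBinom_succ
  rw [← h1, ← h2] at h3
  refine Nat.eq_of_mul_eq_mul_left (Nat.succ_pos n) ?_
  linarith

theorem tendsto_catalan_div_catalan_succ :
    Tendsto (fun n => (catalan n : ℝ) / catalan (n + 1)) atTop (𝓝 (1 / 4)) := by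
  have h : ∀ n : ℕ, (catalan n : ℝ) / catalan (n + 1) = ((n : ℝ) + 2) / (4 * n + 2) := by
    intro n
    have h1 : ((n : ℝ) + 2) * catalan (n + 1) = (4 * n + 2) * catalan n := by
      exact_mod_cast catalan_succ_mul n
    have h2 : (0 : ℝ) < catalan (n + 1) := by exact_mod_cast catalan_pos _
    rw [div_eq_div_iff h2.ne' (by positivity)]
    linarith
  simp only [h]
  -- This is the exact difference between `(n + 2) / (4n + 2)` and `1/4`.
  have h0 : Tendsto (fun n : ℕ => (3 / 2 : ℝ) / (4 * n + 2)) atTop (𝓝 0) := by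
    refine tendsto_const_nhds.div_atTop (tendsto_atTop_add_const_right _ _ ?_)
    exact tendsto_natCast_atTop_atTop.const_mul_atTop (by norm_num)
  have h1 := h0.add_const (1 / 4 : ℝ)
  rw [zero_add] at h1
  refine h1.congr fun n => ?_
  field_simp
  ring

theorem tendsto_catalan_div_catalan_add (j : ℕ) :
    Tendsto (fun n => (catalan n : ℝ) / catalan (n + j)) atTop (𝓝 ((1 / 4) ^ j)) := by
  induction j with
  | zero =>
    refine tendsto_const_nhds.congr fun n => ?_
    have h2 : (0 : ℝ) < catalan n := by exact_mod_cast catalan_pos _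
    rw [pow_zero, add_zero, div_self h2.ne']
  | succ j ih =>
    have h := ih.mul ((tendsto_add_atTop_iff_nat j).mpr tendsto_catalan_div_catalan_succ)
    rw [← pow_succ] at h
    refine h.congr fun n => ?_
    have h2 : (0 : ℝ) < catalan (n + j) := by exact_mod_cast catalan_pos _
    rw [div_mul_div_cancel₀ h2.ne', add_assoc]

/-- The probability that the smallest value of a random `213`-avoiding permutation of length
`n + 1` stands at the position `j + 1`. -/
noncomputable def catalanWeight (n j : ℕ) : ℝ :=
  (catalan j : ℝ) * catalan (n - j) / catalan (n + 1)

theorem catalanWeight_nonneg (n j : ℕ) : 0 ≤ catalanWeight n j := by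
  unfold catalanWeight
  positivity

theorem sum_catalanWeight (n : ℕ) : ∑ j ∈ Finset.range (n + 1), catalanWeight n j = 1 := by
  have h2 : (0 : ℝ) < catalan (n + 1) := by exact_mod_cast catalan_pos _
  simp only [catalanWeight]
  rw [← Finset.sum_div, div_eq_one_iff_eq h2.ne', catalan_succ, Finset.sum_range]
  push_cast
  rfl

theorem catalanWeight_sub {n j : ℕ} (h : j ≤ n) : catalanWeight n (n - j) = catalanWeight n j := by
  rw [catalanWeight, catalanWeight, Nat.sub_sub_self h, mul_comm (catalan j : ℝ)]

theorem tendsto_catalanWeight (j : ℕ) :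
    Tendsto (fun n => catalanWeight n j) atTop (𝓝 ((catalan j : ℝ) / 4 ^ (j + 1))) := by
  refine (tendsto_add_atTop_iff_nat j).mp ?_
  have h := (tendsto_catalan_div_catalan_add (j + 1)).const_mul (catalan j : ℝ)
  rw [one_div_pow, mul_one_div] at h
  refine h.congr fun n => ?_
  rw [catalanWeight, Nat.add_sub_cancel, mul_div_assoc, add_assoc]

end Catalan

/-! ### Convergence of averages by contraction -/

namespace PatternAvoidance

theorem abs_sum_div_card_sub_le {ι : Type*} {s : Finset ι} (hs : s.Nonempty) {F G : ι → ℝ} {b : ℝ}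
    (h : ∀ i ∈ s, |F i - G i| ≤ b) :
    |(∑ i ∈ s, F i) / s.card - (∑ i ∈ s, G i) / s.card| ≤ b := by
  have hpos : (0 : ℝ) < s.card := by exact_mod_cast hs.card_pos
  rw [← sub_div, abs_div, abs_of_pos hpos, div_le_iff₀ hpos, ← Finset.sum_sub_distrib]
  refine (Finset.abs_sum_le_sum_abs _ _).trans ((Finset.sum_le_sum h).trans ?_)
  rw [Finset.sum_const, nsmul_eq_mul, mul_comm]

theorem abs_sum_div_card_sub_const_le {ι : Type*} {s : Finset ι} (hs : s.Nonempty) {F : ι → ℝ}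
    {b c : ℝ} (h : ∀ i ∈ s, |F i - c| ≤ b) : |(∑ i ∈ s, F i) / s.card - c| ≤ b := by
  have hpos : (0 : ℝ) < s.card := by exact_mod_cast hs.card_pos
  have := abs_sum_div_card_sub_le hs h
  rwa [Finset.sum_const, nsmul_eq_mul, mul_div_cancel_left₀ _ hpos.ne'] at this

variable {j k n : ℕ} (h : j + k = n)

/-- The average of `f` over the `213`-avoiding permutations of length `j + k + 1` whose smallest
value stands at the position `j + 1`. -/
noncomputable def blockAverage (f : SeqSpace → ℝ) : ℝ :=
  (∑ x ∈ avoiders j ×ˢ avoiders k, f (toSeqSpace (glue h x.1 x.2))) /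
    (avoiders j ×ˢ avoiders k).card

theorem abs_blockAverage_sub_const_le {f : SeqSpace → ℝ} {b c : ℝ} (hf : ∀ σ, |f σ - c| ≤ b) :
    |blockAverage h f - c| ≤ b :=
  abs_sum_div_card_sub_const_le ((avoiders_nonempty j).product (avoiders_nonempty k))
    fun _ _ => hf _

/-- After replacing `glue` by `prepend j`, the left block no longer matters and its average cancels.
-/
theorem abs_blockAverage_sub_prepend_le {f : SeqSpace → ℝ} {K : NNReal} (hf : LipschitzWith K f) :
    |blockAverage h f - average k (f ∘ SeqSpace.prepend j)| ≤ K * (4 * (1 / 2) ^ k) := by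
  have h1 : average k (f ∘ SeqSpace.prepend j) =
      (∑ x ∈ avoiders j ×ˢ avoiders k, f (SeqSpace.prepend j (toSeqSpace x.2))) /
        (avoiders j ×ˢ avoiders k).card := by
    have hj : ((avoiders j).card : ℝ) ≠ 0 := by exact_mod_cast (avoiders_nonempty j).card_pos.ne'
    rw [Finset.sum_product]
    dsimp only
    rw [Finset.sum_const, Finset.card_product, nsmul_eq_mul, Nat.cast_mul,
      mul_div_mul_left _ _ hj, average, card_avoiders]
    rfl
  rw [h1]
  refine abs_sum_div_card_sub_le ((avoiders_nonempty j).product (avoiders_nonempty k))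
    fun x _ => ?_
  rw [← Real.dist_eq]
  refine (hf.dist_le_mul _ _).trans ?_
  gcongr
  exact dist_glue_prepend h x.1 x.2

theorem abs_blockAverage_sub_shift_le {f : SeqSpace → ℝ} {K : NNReal} (hf : LipschitzWith K f) :
    |blockAverage h f - average j (f ∘ SeqSpace.shift k.succPNat)| ≤ K * (4 * (1 / 2) ^ j) := by
  have h1 : average j (f ∘ SeqSpace.shift k.succPNat) =
      (∑ x ∈ avoiders j ×ˢ avoiders k, f (SeqSpace.shift k.succPNat (toSeqSpace x.1))) /
        (avoiders j ×ˢ avoiders k).card := by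
    have hk : ((avoiders k).card : ℝ) ≠ 0 := by exact_mod_cast (avoiders_nonempty k).card_pos.ne'
    rw [Finset.sum_product_right]
    dsimp only
    rw [Finset.sum_const, Finset.card_product, nsmul_eq_mul,
      mul_comm (avoiders j).card, Nat.cast_mul, mul_div_mul_left _ _ hk, average, card_avoiders]
    rfl
  rw [h1]
  refine abs_sum_div_card_sub_le ((avoiders_nonempty j).product (avoiders_nonempty k))
    fun x _ => ?_
  rw [← Real.dist_eq]
  refine (hf.dist_le_mul _ _).trans ?_
  gcongr
  exact dist_glue_shift h x.1 x.2

/-- `blockAverage` for the splitting `n = j + (n - j)`. -/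
noncomputable def splitAverage (f : SeqSpace → ℝ) (c : ℝ) (n j : ℕ) : ℝ :=
  if h : j ≤ n then blockAverage (Nat.add_sub_of_le h) f else c

theorem average_succ (f : SeqSpace → ℝ) (c : ℝ) (n : ℕ) :
    average (n + 1) f =
      ∑ j ∈ Finset.range (n + 1), catalanWeight n j * splitAverage f c n j := by
  rw [average, sum_avoiders_succ, Finset.sum_div, Finset.sum_range]
  refine Finset.sum_congr rfl fun j _ => ?_
  have hj : (catalan j : ℝ) ≠ 0 := by exact_mod_cast (catalan_pos _).ne'
  have hk : (catalan (n - j) : ℝ) ≠ 0 := by exact_mod_cast (catalan_pos _).ne'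
  rw [splitAverage, dif_pos (Nat.le_of_lt_succ j.2), blockAverage, catalanWeight,
    Finset.card_product, card_avoiders, card_avoiders, Finset.sum_product, Nat.cast_mul]
  field_simp

theorem tendsto_four_mul_half_pow (K : ℝ) (j : ℕ) :
    Tendsto (fun n : ℕ => K * (4 * (1 / 2 : ℝ) ^ (n - j))) atTop (𝓝 0) := by
  have h1 : Tendsto (fun n : ℕ => (1 / 2 : ℝ) ^ (n - j)) atTop (𝓝 0) :=
    (tendsto_pow_atTop_nhds_zero_of_lt_one (by norm_num) (by norm_num)).comp
      (tendsto_sub_atTop_nat j)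
  simpa using (h1.const_mul 4).const_mul K

section Convergence

variable {Λ : Measure SeqSpace} [IsProbabilityMeasure Λ]

theorem integrable_of_lipschitzWith {f : SeqSpace → ℝ} {K : NNReal} (hf : LipschitzWith K f)
    (ν : Measure SeqSpace) [IsFiniteMeasure ν] : Integrable f ν :=
  hf.continuous.integrable_of_hasCompactSupport (HasCompactSupport.of_compactSpace f)

theorem hasSum_integral_of_eq_sum {v : ℕ → ℝ} (hv : ∀ j, 0 ≤ v j)
    (hΛ : Λ = Measure.sum fun j : ℕ => ENNReal.ofReal (v j) •
      (Λ.map (SeqSpace.prepend j) + Λ.map (SeqSpace.shift j.succPNat)))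
    {f : SeqSpace → ℝ} {K : NNReal} (hf : LipschitzWith K f) :
    HasSum (fun j => v j * (∫ σ, (f ∘ SeqSpace.prepend j) σ ∂Λ +
      ∫ σ, (f ∘ SeqSpace.shift j.succPNat) σ ∂Λ)) (∫ σ, f σ ∂Λ) := by
  have hint := integrable_of_lipschitzWith hf Λ
  have hs := hint
  rw [hΛ] at hs
  have h1 := hasSum_integral_measure hs
  rw [← hΛ] at h1
  refine h1.congr_fun ?_
  intro j
  have hp := SeqSpace.measurable_prepend j
  have hsh := SeqSpace.measurable_shift j.succPNat
  have := Measure.isProbabilityMeasure_map hp.aemeasurable (μ := Λ)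
  have := Measure.isProbabilityMeasure_map hsh.aemeasurable (μ := Λ)
  rw [integral_smul_measure, ENNReal.toReal_ofReal (hv j), smul_eq_mul,
    integral_add_measure (integrable_of_lipschitzWith hf _) (integrable_of_lipschitzWith hf _),
    integral_map hp.aemeasurable hf.continuous.aestronglyMeasurable,
    integral_map hsh.aemeasurable hf.continuous.aestronglyMeasurable]
  rfl

/-- The space has diameter at most `2`; this crude bound starts the iteration. -/
theorem abs_average_sub_integral_le {f : SeqSpace → ℝ} {K : NNReal} (hf : LipschitzWith K f)
    (n : ℕ) : |average n f - ∫ σ, f σ ∂Λ| ≤ K * 2 := by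
  have hosc : ∀ σ τ, |f σ - f τ| ≤ K * 2 := fun σ τ => by
    rw [← Real.dist_eq]
    exact (hf.dist_le_mul _ _).trans (by gcongr; exact SeqSpace.dist_le_two _ _)
  rw [average, ← card_avoiders]
  refine abs_sum_div_card_sub_const_le (avoiders_nonempty n) fun τ _ => ?_
  have hint := integrable_of_lipschitzWith hf Λ
  have : f (toSeqSpace τ) - ∫ σ, f σ ∂Λ = ∫ σ, (f (toSeqSpace τ) - f σ) ∂Λ := by
    rw [integral_sub (integrable_const _) hint]
    simp
  rw [this, ← Real.norm_eq_abs]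
  refine (norm_integral_le_of_norm_le_const (C := K * 2) (ae_of_all _ fun σ => hosc _ _)).trans ?_
  simp

/-- A fixed point of the splitting recursion is approximated by the averages up to an error that
each application of the recursion halves. -/
theorem eventually_abs_average_sub_integral_le
    (hv : HasSum (fun j => (catalan j : ℝ) / 4 ^ (j + 1)) (1 / 2))
    (hΛ : Λ = Measure.sum fun j : ℕ => ENNReal.ofReal ((catalan j : ℝ) / 4 ^ (j + 1)) •
      (Λ.map (SeqSpace.prepend j) + Λ.map (SeqSpace.shift j.succPNat))) (M : ℕ) :
    ∀ {f : SeqSpace → ℝ} {K : NNReal}, LipschitzWith K f → ∀ ε > 0, ∀ᶠ n in atTop,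
      |average n f - ∫ σ, f σ ∂Λ| ≤ K * 2 * (1 / 2) ^ M + ε := by
  induction M with
  | zero =>
    intro f K hf ε hε
    refine Eventually.of_forall fun n => (abs_average_sub_integral_le hf n).trans ?_
    rw [pow_zero, mul_one]
    linarith
  | succ M ih =>
    intro f K hf
    -- The induction hypothesis is applied to `f ∘ prepend j` and `f ∘ shift`, whose Lipschitz
    -- constant is `K / 2`; here the error is halved.
    have hδ : ((K * (1 / 2) : NNReal) : ℝ) * 2 * (1 / 2) ^ M = K * 2 * (1 / 2) ^ (M + 1) := by
      push_cast
      ring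
    have hA : ∀ j, LipschitzWith (K * (1 / 2)) (f ∘ SeqSpace.prepend j) := fun j =>
      hf.comp (SeqSpace.lipschitzWith_prepend j)
    have hB : ∀ j : ℕ, LipschitzWith (K * (1 / 2)) (f ∘ SeqSpace.shift j.succPNat) := fun j =>
      hf.comp (SeqSpace.lipschitzWith_shift _)
    -- Any value of `f` would do. It is also the default of `splitAverage` for `j > n`, where the
    -- centred bound is then trivial.
    set c := f (toSeqSpace (1 : Equiv.Perm (Fin 0))) with hc
    have hosc : ∀ σ, |f σ - c| ≤ K * 2 := fun σ => by
      rw [← Real.dist_eq]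
      exact (hf.dist_le_mul _ _).trans (by gcongr; exact SeqSpace.dist_le_two _ _)
    intro ε hε
    have hmain := eventually_abs_weighted_sum_sub_le hv catalanWeight_nonneg sum_catalanWeight
      (fun n j => catalanWeight_sub) tendsto_catalanWeight (a := splitAverage f c) (c := c)
      (b := K * 2) (δ := K * 2 * (1 / 2) ^ (M + 1))
      (hasSum_integral_of_eq_sum (fun j => by positivity) hΛ hf) ?_ ?_ ?_ (by positivity) ε hε
    · have h1 : ∀ᶠ n in atTop, |average (n + 1) f - ∫ σ, f σ ∂Λ| ≤
          K * 2 * (1 / 2) ^ (M + 1) + ε := by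
        simpa only [average_succ f c] using hmain
      rw [← Filter.map_add_atTop_eq_nat 1]
      exact h1
    · intro n j
      unfold splitAverage
      split_ifs with h
      · exact abs_blockAverage_sub_const_le _ hosc
      · rw [sub_self, abs_zero]
        positivity
    · intro j ε hε
      have h1 := (tendsto_sub_atTop_nat j).eventually (ih (hA j) (ε / 2) (by positivity))
      have h2 := (tendsto_four_mul_half_pow K j).eventually_lt_const (half_pos hε)
      filter_upwards [h1, h2, eventually_ge_atTop j] with n h1 h2 hn
      rw [hδ] at h1
      rw [splitAverage, dif_pos hn]
      have h3 := abs_blockAverage_sub_prepend_le (Nat.add_sub_of_le hn) hf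
      refine (abs_sub_le _ _ _).trans ((add_le_add h3 h1).trans ?_)
      linarith
    · intro j ε hε
      have h1 := (tendsto_sub_atTop_nat j).eventually (ih (hB j) (ε / 2) (by positivity))
      have h2 := (tendsto_four_mul_half_pow K j).eventually_lt_const (half_pos hε)
      filter_upwards [h1, h2, eventually_ge_atTop j] with n h1 h2 hn
      rw [hδ] at h1
      rw [splitAverage, dif_pos (Nat.sub_le n j)]
      have h3 := abs_blockAverage_sub_shift_le (Nat.add_sub_of_le (Nat.sub_le n j)) hf
      rw [show average (n - j) (f ∘ SeqSpace.shift (n - (n - j)).succPNat) =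
        average (n - j) (f ∘ SeqSpace.shift j.succPNat) by rw [Nat.sub_sub_self hn]] at h3
      refine (abs_sub_le _ _ _).trans ((add_le_add h3 h1).trans ?_)
      linarith

theorem tendsto_average_integral
    (hv : HasSum (fun j => (catalan j : ℝ) / 4 ^ (j + 1)) (1 / 2))
    (hΛ : Λ = Measure.sum fun j : ℕ => ENNReal.ofReal ((catalan j : ℝ) / 4 ^ (j + 1)) •
      (Λ.map (SeqSpace.prepend j) + Λ.map (SeqSpace.shift j.succPNat)))
    {f : SeqSpace → ℝ} {K : NNReal} (hf : LipschitzWith K f) :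
    Tendsto (fun n => average n f) atTop (𝓝 (∫ σ, f σ ∂Λ)) := by
  rw [tendsto_iff_norm_sub_tendsto_zero, tendsto_order]
  refine ⟨fun a ha => Eventually.of_forall fun n => ha.trans_le (norm_nonneg _), fun ε hε => ?_⟩
  have hpow : Tendsto (fun M : ℕ => (K * 2 : ℝ) * (1 / 2) ^ M) atTop (𝓝 0) := by
    simpa using (tendsto_pow_atTop_nhds_zero_of_lt_one (r := (1 / 2 : ℝ)) (by norm_num)
      (by norm_num)).const_mul (K * 2 : ℝ)
  obtain ⟨M, hM⟩ := (hpow.eventually_lt_const (half_pos hε)).exists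
  filter_upwards [eventually_abs_average_sub_integral_le hv hΛ M hf (ε / 2) (half_pos hε)]
    with n hn
  rw [Real.norm_eq_abs]
  linarith

end Convergence

end PatternAvoidance

/-! ### Almost sure properties and conclusion -/

namespace Limit213

variable {Ω : Type*} [MeasurableSpace Ω] {P : Measure Ω}

theorem ae_exists_ne_zero {X : ℕ → Ω → ℕ}
    (h_indep : iIndep (fun n => Limit213.sigmaAlg (X n)) P)
    (hX_law : ∀ n, P (X n ⁻¹' {0}) = 2⁻¹) : ∀ᵐ ω ∂P, ∃ n, X n ω ≠ 0 := by
  have hI := (iIndepFun_iff_iIndep _ _ _).mpr h_indep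
  rw [ae_iff]
  have hle : ∀ N : ℕ, P {ω | ¬∃ n, X n ω ≠ 0} ≤ (2⁻¹ : ENNReal) ^ N := by
    intro N
    have h := hI.measure_inter_preimage_eq_mul (Finset.range N) (sets := fun _ => {0})
      fun i _ => measurableSet_singleton 0
    rw [Finset.prod_congr rfl fun i _ => hX_law i, Finset.prod_const, Finset.card_range] at h
    rw [← h]
    refine measure_mono fun ω hω => ?_
    simp only [Set.mem_iInter]
    intro i _
    by_contra hne
    exact hω ⟨i, hne⟩
  exact nonpos_iff_eq_zero.mp (ge_of_tendsto'
    (ENNReal.tendsto_pow_atTop_nhds_zero_of_lt_one ENNReal.one_half_lt_one) hle)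

theorem map_singleton_eq_ofReal [IsFiniteMeasure P] {E : Type*} [MeasurableSpace E] [MeasurableSingletonClass E]
    {f : Ω → E} (hf : Measurable f) (k : E) :
    P.map f {k} = ENNReal.ofReal (P.real {ω | f ω = k}) := by
  rw [Measure.map_apply hf (measurableSet_singleton k), ofReal_measureReal]
  rfl

/-- The existence of a variable with the given law supplies the value of the Catalan series, with no
need of its generating function. -/
theorem hasSum_measure_singleton {μ : Measure ℕ} [IsProbabilityMeasure μ] {v : ℕ → ℝ}
    (hv : ∀ k, 0 ≤ v k) (h : ∀ k, μ {k} = ENNReal.ofReal (v k)) : HasSum v 1 := by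
  have h1 : ∑' k, ENNReal.ofReal (v k) = 1 := by
    have := lintegral_countable' (μ := μ) (fun _ : ℕ => (1 : ENNReal))
    simp only [lintegral_const, measure_univ, one_mul, h] at this
    exact this.symm
  have h2 := ENNReal.hasSum_toReal (f := fun k => ENNReal.ofReal (v k)) (by rw [h1]; simp)
  rw [← ENNReal.tsum_toReal_eq fun _ => ENNReal.ofReal_ne_top, h1] at h2
  simpa only [ENNReal.toReal_ofReal (hv _), ENNReal.toReal_one] using h2

end Limit213

/-- `X n`, `Xhat n`, `Y1 n`, `Y2 n` are the terms of index `n + 1` of the sequences `X_1, X_2, …` etc. -/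
theorem theorem213 {Ω : Type*} [MeasurableSpace Ω] (P : ProbabilityMeasure Ω)
    (X : ℕ → Ω → ℕ) (Xhat Y1 Y2 : ℕ → Ω → ℕ+) (χ : Ω → Fin 2)
    (hX_meas : ∀ n, Measurable (X n)) (hXhat_meas : ∀ n, Measurable (Xhat n))
    (hY1_meas : ∀ n, Measurable (Y1 n)) (hY2_meas : ∀ n, Measurable (Y2 n))
    (hχ_meas : Measurable χ)
    (h_indep : iIndep
      (Sum.elim (fun n => Limit213.sigmaAlg (X n))
        (Sum.elim (fun n => Limit213.sigmaAlg (Xhat n))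
          (Sum.elim (fun n => Limit213.sigmaAlg (Y1 n))
            (Sum.elim (fun n => Limit213.sigmaAlg (Y2 n))
              (fun _ : Unit => Limit213.sigmaAlg χ))))) (P : Measure Ω))
    (hX_law : ∀ n k : ℕ,
      (P : Measure Ω).real {ω | X n ω = k} = (catalan k : ℝ) / (2 * 4 ^ k))
    (hXhat_law : ∀ n k : ℕ,
      (P : Measure Ω).real {ω | (Xhat n ω : ℕ) = k + 1} = (catalan k : ℝ) / (2 * 4 ^ k))
    (hY1_law : ∀ (n : ℕ) (k : ℕ+), (P : Measure Ω).real {ω | Y1 n ω = k} = (1 / 2) ^ (k : ℕ))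
    (hY2_law : ∀ (n : ℕ) (k : ℕ+), (P : Measure Ω).real {ω | Y2 n ω = k} = (1 / 2) ^ (k : ℕ))
    (hχ_law : ∀ c : Fin 2, (P : Measure Ω).real {ω | χ ω = c} = 1 / 2) :
    (∀ᵐ ω ∂(P : Measure Ω),
      Limit213.limitFun (X · ω) (Xhat · ω) (Y1 · ω) (Y2 · ω) (χ ω) ∉ SeqSpace.injections ∧
      Limit213.limitFun (X · ω) (Xhat · ω) (Y1 · ω) (Y2 · ω) (χ ω) ∉ SeqSpace.surjections) ∧
    ∃ hZ : Measurable fun ω =>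
        Limit213.limitFun (X · ω) (Xhat · ω) (Y1 · ω) (Y2 · ω) (χ ω),
      Tendsto PatternAvoidance.mu213 atTop (𝓝 (P.map hZ.aemeasurable)) := by
  have half : ENNReal.ofReal (1 / 2) = 2⁻¹ := by
    rw [one_div, ENNReal.ofReal_inv_of_pos two_pos, ENNReal.ofReal_ofNat]
  have hXhat_law' : ∀ n k, (P : Measure Ω).real {ω | Xhat n ω = k} =
      (catalan k.natPred : ℝ) / (2 * 4 ^ k.natPred) := by
    intro n k
    rw [← hXhat_law n k.natPred]
    congr 1
    ext ω
    simp only [Set.mem_ofPred_eq, PNat.natPred_add_one, PNat.coe_inj]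
  have hZ : Measurable fun ω => Limit213.limitFun (X · ω) (Xhat · ω) (Y1 · ω) (Y2 · ω) (χ ω) :=
    Limit213.measurable_limitFun (measurable_pi_lambda _ hX_meas)
      (measurable_pi_lambda _ hXhat_meas) (measurable_pi_lambda _ hY1_meas)
      (measurable_pi_lambda _ hY2_meas) hχ_meas
  refine ⟨?_, hZ, ?_⟩
  · filter_upwards [Limit213.ae_exists_ne_zero h_indep.sumElim_left fun n => by
      have := hX_law n 0
      rw [catalan_zero, Nat.cast_one, pow_zero, mul_one] at this
      rw [← half, ← this, ofReal_measureReal]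
      rfl] with ω hω
    unfold Limit213.limitFun
    split_ifs
    · exact ⟨Limit213.concat_notMem_injections _ hω,
        Limit213.concat_notMem_surjections _ (Limit213.exists_notMem_valueSet1 _ _ _)⟩
    · exact ⟨Limit213.concat_notMem_injections _ hω,
        Limit213.concat_notMem_surjections _ (Limit213.exists_notMem_valueSet0 _ _ _)⟩
  set μ := (P : Measure Ω).map (X 0) with hμ
  set μh := (P : Measure Ω).map (Xhat 0) with hμh
  set γ := (P : Measure Ω).map (Y1 0) with hγ
  have : IsProbabilityMeasure μ := Measure.isProbabilityMeasure_map (hX_meas 0).aemeasurable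
  have : IsProbabilityMeasure μh := Measure.isProbabilityMeasure_map (hXhat_meas 0).aemeasurable
  have : IsProbabilityMeasure γ := Measure.isProbabilityMeasure_map (hY1_meas 0).aemeasurable
  have hμ_apply : ∀ k, μ {k} = ENNReal.ofReal ((catalan k : ℝ) / (2 * 4 ^ k)) := fun k => by
    rw [hμ, Limit213.map_singleton_eq_ofReal (hX_meas 0), hX_law]
  have hμh_apply : ∀ k : ℕ, μh {k.succPNat} = μ {k} := fun k => by
    rw [hμh, Limit213.map_singleton_eq_ofReal (hXhat_meas 0), hXhat_law', hμ_apply,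
      Nat.natPred_succPNat]
  have hγ_apply : ∀ k : ℕ+, γ {k} = (2⁻¹ : ENNReal) ^ (k : ℕ) := fun k => by
    rw [hγ, Limit213.map_singleton_eq_ofReal (hY1_meas 0), hY1_law,
      ENNReal.ofReal_pow (by norm_num), half]
  have hlaw : (P : Measure Ω).map (fun ω =>
      Limit213.limitFun (X · ω) (Xhat · ω) (Y1 · ω) (Y2 · ω) (χ ω)) =
      Limit213.limitLaw μ μh γ := by
    refine Limit213.map_limitFun_eq hX_meas hXhat_meas hY1_meas hY2_meas hχ_meas
      (Limit213.map_tuple_eq hX_meas hXhat_meas hY1_meas hY2_meas hχ_meas h_indep ?_ ?_ ?_ ?_) ?_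
    · exact fun n => map_eq_map_of_real_eq (hX_meas n) (hX_meas 0) fun k => by
        rw [hX_law, hX_law]
    · exact fun n => map_eq_map_of_real_eq (hXhat_meas n) (hXhat_meas 0) fun k => by
        rw [hXhat_law', hXhat_law']
    · exact fun n => map_eq_map_of_real_eq (hY1_meas n) (hY1_meas 0) fun k => by
        rw [hY1_law, hY1_law]
    · exact fun n => map_eq_map_of_real_eq (hY2_meas n) (hY1_meas 0) fun k => by
        rw [hY2_law, hY1_law]
    · intro c
      rw [Limit213.map_singleton_eq_ofReal hχ_meas, hχ_law, half]
  have hweight : ∀ j : ℕ, (catalan j : ℝ) / 4 ^ (j + 1) = 1 / 2 * ((catalan j : ℝ) / (2 * 4 ^ j)) :=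
    fun j => by
      rw [pow_succ]
      field_simp
      norm_num
  have hsum : HasSum (fun j => (catalan j : ℝ) / 4 ^ (j + 1)) (1 / 2) := by
    have h := (Limit213.hasSum_measure_singleton (μ := μ) (fun k => by positivity)
      hμ_apply).mul_left (1 / 2 : ℝ)
    rw [mul_one] at h
    simpa only [hweight] using h
  have hrec := Limit213.limitLaw_eq_sum μ μh γ hμh_apply hγ_apply
  have hcoef : ∀ j, (2⁻¹ : ENNReal) * μ {j} = ENNReal.ofReal ((catalan j : ℝ) / 4 ^ (j + 1)) :=
    fun j => by rw [hweight, ENNReal.ofReal_mul (by norm_num), half, hμ_apply]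
  simp only [hcoef] at hrec
  have hprob : IsProbabilityMeasure (Limit213.limitLaw μ μh γ) := by
    rw [← hlaw]
    exact Measure.isProbabilityMeasure_map hZ.aemeasurable
  -- Weak convergence only has to be tested on bounded Lipschitz functions, the class on which the
  -- contraction acts.
  rw [tendsto_iff_forall_lipschitz_integral_tendsto]
  rintro f - ⟨K, hf⟩
  have h := PatternAvoidance.tendsto_average_integral hsum hrec hf
  simp only [PatternAvoidance.integral_mu213 _ f hf.continuous.measurable]
  rwa [ProbabilityMeasure.toMeasure_map, hlaw]
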